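/- Let $A\in\mathbb R^{n\times n}$ and $B\in\mathbb R^{n}$ with $(A,B)$ stabilizable, and consider the plant $x(k+1)=Ax(k)+B\,(w(k)+u_d(k))$, $x(0)=0$, $k\ge 0$, whose state $x$ is measured. The plant input is received through an analog erasure channel, $u_d(k)=\theta_k u(k)$, where $(\theta_k)$ is an i.i.d. process with $\Pr\{\theta_k=0\}=e$ and $\Pr\{\theta_k=1\}=1-e$, and $u$ is the output of a proper finite-dimensional LTI controller $K$ driven by $x$ with zero initial state. Let $\lambda_i$ be the unstable poles of the plant, i.e. the eigenvalues of $A$ with $|\lambda_i|\ge 1$, counted with algebraic multiplicity, and put $\mathcal M=\prod_i|\lambda_i|$ (with $\mathcal M=1$ if there are none). Let $0\le e\le 1$, and if $e=1$ assume that the plant has at least one unstable pole. The closed loop is mean-square stable if the nominal loop (the channel replaced by its mean gain $1-e$) is internally stable and, for every i.i.d. input $w$ of finite variance independent of $(\theta_k)$, the variances of $u(k)$ and of $d(k)=u_d(k)-(1-e)u(k)$ are bounded in $k$. Let $\mathcal K$ be the set of controllers for which this holds; the system is mean-square stabilizable if $\mathcal K\neq\emptyset$. For $w$ i.i.d. with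 zero mean and unit variance, independent of $(\theta_k)$, the average control power is $\|u_d\|_{\mathcal P}^2=\mathbb E\big\{\lim_{N\to\infty}\frac1{N+1}\sum_{k=0}^{N}u_d(k)^2\big\}$, the limit being taken in $L^1$. Then the following hold. (1) If $e>0$, then with $\varGamma_e=\frac{1-e}{e}$ the system is mean-square stabilizable if and only if $\frac12\log(1+\varGamma_e)>\sum_i\log|\lambda_i|$. (2) The system is mean-square stabilizable if and only if $e<\mathcal M^{-2}$. (3) If the system is mean-square stabilizable, then the average control power exists for every $K\in\mathcal K$, and $$\inf_{K\in\mathcal K}\|u_d\|_{\mathcal P}^2=\frac{\mathcal M^2-1}{1-e\,\mathcal M^2}.$$ If moreover $A$ has no eigenvalue on the unit circle, the infimum is a minimum. -/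

import Mathlib

open MeasureTheory ProbabilityTheory Filter Topology

noncomputable section

namespace ErasureControl

/-- The eigenvalues of a real square matrix in `ℂ`, with algebraic multiplicity. -/
def eigs {ι : Type*} [Fintype ι] [DecidableEq ι] (A : Matrix ι ι ℝ) : Multiset ℂ :=
  (A.map (algebraMap ℝ ℂ)).charpoly.roots

/-- All eigenvalues lie in the open unit disc (asymptotic stability in discrete time). -/
def SchurStable {ι : Type*} [Fintype ι] [DecidableEq ι] (A : Matrix ι ι ℝ) : Prop :=
  ∀ z ∈ eigs A, ‖z‖ < 1

/-- The single-input pair `(A, B)` is stabilizable. -/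
def Stabilizable {n : ℕ} (A : Matrix (Fin n) (Fin n) ℝ) (B : Fin n → ℝ) : Prop :=
  ∃ F : Fin n → ℝ, SchurStable (A + Matrix.vecMulVec B F)

open Classical in
/-- The unstable poles (outside the open unit disc), with multiplicity, of the plant
`x(k+1) = A x(k) + B (w(k) + u_d(k))`, whose state is measured and for which `(A, B)` is
stabilizable. -/
def unstablePoles {n : ℕ} (A : Matrix (Fin n) (Fin n) ℝ) : Multiset ℂ :=
  (eigs A).filter fun z => 1 ≤ ‖z‖

/-- The product of the moduli of the unstable poles. -/
def poleProduct {n : ℕ} (A : Matrix (Fin n) (Fin n) ℝ) : ℝ :=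
  ((unstablePoles A).map fun z => ‖z‖).prod

/-- A proper finite-dimensional LTI controller fed by the plant state `x`:
`ξ(k+1) = Ac ξ(k) + Bc x(k)`, `u(k) = Cc ξ(k) + Dc x(k)`, with `ξ(0) = 0`. -/
structure Controller (n : ℕ) where
  order : ℕ
  Ac : Matrix (Fin order) (Fin order) ℝ
  Bc : Matrix (Fin order) (Fin n) ℝ
  Cc : Fin order → ℝ
  Dc : Fin n → ℝ

/-- The controller output `u` for the plant state `s.1` and the controller state `s.2`. -/
def Controller.output {n : ℕ} (K : Controller n) (s : (Fin n → ℝ) × (Fin K.order → ℝ)) : ℝ :=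
  K.Cc ⬝ᵥ s.2 + K.Dc ⬝ᵥ s.1

section Loop

variable {n : ℕ} (A : Matrix (Fin n) (Fin n) ℝ) (B : Fin n → ℝ) (K : Controller n)

/-- The joint state `(x(k), ξ(k))` of plant and controller along one realization of the channel
gains `θ` and of the input `w`, where `u_d(k) = θ(k) u(k)`. -/
def loopState (θ w : ℕ → ℝ) : ℕ → (Fin n → ℝ) × (Fin K.order → ℝ)
  | 0 => (0, 0)
  | k + 1 =>
    let s := loopState θ w k
    (A.mulVec s.1 + (w k + θ k * K.output s) • B, K.Ac.mulVec s.2 + K.Bc.mulVec s.1)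

/-- The controller output `u(k)`. -/
def ctrl (θ w : ℕ → ℝ) (k : ℕ) : ℝ := K.output (loopState A B K θ w k)

/-- The corrupted control signal `u_d(k) = θ(k) u(k)` received by the plant. -/
def corruptedCtrl (θ w : ℕ → ℝ) (k : ℕ) : ℝ := θ k * ctrl A B K θ w k

/-- The residual signal `d(k) = u_d(k) - (1 - e) u(k)`. -/
def residual (e : ℝ) (θ w : ℕ → ℝ) (k : ℕ) : ℝ :=
  corruptedCtrl A B K θ w k - (1 - e) * ctrl A B K θ w k

/-- The state matrix of the nominal loop: the channel is replaced by its mean gain `1 - e`. -/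
def nominalMatrix (e : ℝ) : Matrix (Fin n ⊕ Fin K.order) (Fin n ⊕ Fin K.order) ℝ :=
  Matrix.fromBlocks (A + (1 - e) • Matrix.vecMulVec B K.Dc) ((1 - e) • Matrix.vecMulVec B K.Cc)
    K.Bc K.Ac

end Loop

/-- The random environment of the loop: `θ` is an i.i.d. Bernoulli process with erasure
probability `e`, and `w` is an i.i.d. process with finite variance, independent of `θ`. -/
structure IsEnvironment {Ω : Type*} [MeasurableSpace Ω] (P : Measure Ω) (e : ℝ)
    (θ w : ℕ → Ω → ℝ) : Prop where
  measurable_channel : ∀ k, Measurable (θ k)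
  indep_channel : iIndepFun θ P
  prob_erased : ∀ k, P {ω | θ k ω = 0} = ENNReal.ofReal e
  prob_received : ∀ k, P {ω | θ k ω = 1} = ENNReal.ofReal (1 - e)
  measurable_input : ∀ k, Measurable (w k)
  indep_input : iIndepFun w P
  ident_input : ∀ k, IdentDistrib (w k) (w 0) P P
  memLp_input : ∀ k, MemLp (w k) 2 P
  indep_input_channel : IndepFun (fun ω k => w k ω) (fun ω k => θ k ω) P

section Performance

variable {n : ℕ} (A : Matrix (Fin n) (Fin n) ℝ) (B : Fin n → ℝ) (e : ℝ) (K : Controller n)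

/-- Mean-square stability of the closed loop: the nominal loop is internally stable, and for every
i.i.d. input of finite variance that is independent of the channel, the variances of `u(k)` and
of `d(k)` are bounded in `k`. -/
def MeanSquareStable : Prop :=
  SchurStable (nominalMatrix A B K e) ∧
  ∀ (Ω : Type) [MeasurableSpace Ω] (P : Measure Ω) [IsProbabilityMeasure P] (θ w : ℕ → Ω → ℝ),
    IsEnvironment P e θ w →
    ∃ C : ℝ, ∀ k : ℕ,
      variance (fun ω => ctrl A B K (fun j => θ j ω) (fun j => w j ω) k) P ≤ C ∧
      variance (fun ω => residual A B K e (fun j => θ j ω) (fun j => w j ω) k) P ≤ C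

/-- The time average `(1 / (N + 1)) ∑_{k = 0}^{N} u_d(k)²` along one realization. -/
def timeAverage (θ w : ℕ → ℝ) (N : ℕ) : ℝ :=
  (∑ k ∈ Finset.range (N + 1), corruptedCtrl A B K θ w k ^ 2) / ((N : ℝ) + 1)

/-- `J` is the average power of `u_d`, i.e. the expectation of the limit of the time averages of
`u_d(k)²`, when `w` is i.i.d. with zero mean and unit variance and independent of the channel.
The limit of these random variables is taken in `L¹`, so that `J` is also the limit of the
expected time averages. -/
def HasAveragePower (J : ℝ) : Prop :=
  ∀ (Ω : Type) [MeasurableSpace Ω] (P : Measure Ω) [IsProbabilityMeasure P] (θ w : ℕ → Ω → ℝ),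
    IsEnvironment P e θ w → (∫ ω, w 0 ω ∂P = 0) → variance (w 0) P = 1 →
    ∃ L : Ω → ℝ, Integrable L P ∧
      Tendsto (fun N => eLpNorm
        (fun ω => timeAverage A B K (fun j => θ j ω) (fun j => w j ω) N - L ω) 1 P)
        atTop (𝓝 0) ∧
      ∫ ω, L ω ∂P = J

end Performance

/-- Some controller makes the closed loop mean-square stable. -/
def MeanSquareStabilizable {n : ℕ} (A : Matrix (Fin n) (Fin n) ℝ) (B : Fin n → ℝ) (e : ℝ) : Prop :=
  ∃ K : Controller n, MeanSquareStable A B e K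

/-- The average powers of `u_d` attained by the mean-square stabilizing controllers. -/
def stabilizingPowers {n : ℕ} (A : Matrix (Fin n) (Fin n) ℝ) (B : Fin n → ℝ) (e : ℝ) : Set ℝ :=
  {J | ∃ K : Controller n, MeanSquareStable A B e K ∧ HasAveragePower A B e K J}

end ErasureControl

end

/-! Write each channel gain as its mean plus a centred fluctuation. The mean part joins the nominal
matrix. The fluctuation times u(k) enters the loop at the same point as w(k), and it is orthogonal
to the past. For standardized input the second moment of u therefore solves a renewal equation whose
kernel is the squared nominal impulse response scaled by e(1-e)
(`IsEnvironment.outputMoment_renewal`). A bounded solution exists exactly when the kernel mass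
e(1-e)·`gain` is below one, and it then converges to `gain` / (1 - e(1-e)·`gain`) (`renewal_bound`,
`renewal_tendsto`). So mean-square stability becomes a deterministic condition
(`meanSquareStable_iff`), and the average power is (1-e) times that limit.

What remains is to minimize x = (1-e)²·`gain` over internally stabilizing controllers. Here 1 + x is
the energy of the return difference S, the quotient of the reversed open-loop and closed-loop
characteristic polynomials (`linProd_mul_returnDiff`). S contains a factor 1 - λX for every unstable
pole λ. Replacing this factor by conj λ - X keeps the energy and multiplies the constant coefficient
by conj λ, so 1 + x ≥ M² (`poleProduct_sq_sub_one_le`). Conversely, a state feedback combined with a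
filter of the plant input makes S equal to the product of the (1 - λX)/(1 - (ρ/conj λ)X). For ρ = 1
this is M times an all-pass function; poles on the unit circle force ρ < 1, and letting ρ tend to 1
approaches the bound (`exists_controller_gain_le`). Since the stability condition is e·x < 1 - e and
the power x/(1 - e - e·x) increases with x, inserting x = M² - 1 gives all the claims.

That the time averages converge in L¹ is shown by blocks. The loop is compared with copies restarted
from rest at the start of every block; block sums of the copies are i.i.d. and obey the law of large
numbers, while the restart error has a total that is bounded uniformly in the restart time and the
block length (`IsEnvironment.tendsto_average_power`). -/

noncomputable section

namespace ErasureControl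

/-! ### Energy of power series and reflection of roots in the unit circle. -/

section Series

open PowerSeries ComplexConjugate

/-- Power series with absolutely summable coefficients. -/
def AbsSummable (f : PowerSeries ℂ) : Prop := Summable fun k => ‖coeff k f‖

/-- The sum of the squared moduli of the coefficients. -/
def energy (f : PowerSeries ℂ) : ℝ := ∑' k, ‖coeff k f‖ ^ 2

/-- The lag-one autocorrelation of the coefficients. -/
def lagCorr (f : PowerSeries ℂ) : ℂ := ∑' k, coeff (k + 1) f * conj (coeff k f)

lemma coeff_zero_affine_mul (a b : ℂ) (f : PowerSeries ℂ) :
    coeff 0 ((C a + C b * X) * f) = a * coeff 0 f := by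
  simp

lemma coeff_succ_affine_mul (a b : ℂ) (f : PowerSeries ℂ) (k : ℕ) :
    coeff (k + 1) ((C a + C b * X) * f) = a * coeff (k + 1) f + b * coeff k f := by
  rw [add_mul, mul_assoc, map_add, coeff_C_mul, coeff_C_mul, mul_comm X f, coeff_succ_mul_X]

lemma AbsSummable.affine_mul {f : PowerSeries ℂ} (hf : AbsSummable f) (a b : ℂ) :
    AbsSummable ((C a + C b * X) * f) := by
  unfold AbsSummable
  rw [← summable_nat_add_iff 1]
  refine Summable.of_nonneg_of_le (fun _ => norm_nonneg _) (fun k => ?_)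
    ((((summable_nat_add_iff 1).2 hf).mul_left ‖a‖).add (Summable.mul_left ‖b‖ hf))
  rw [coeff_succ_affine_mul, ← norm_mul, ← norm_mul]
  exact norm_add_le _ _

/-- With g the product, f(k+1) = g(k+1) + ν f(k). Summing moduli bounds (1 - ‖ν‖) times any partial
sum for f by the full sum for g. -/
lemma AbsSummable.of_affine_mul {f : PowerSeries ℂ} {ν : ℂ} (hν : ‖ν‖ < 1)
    (hf : AbsSummable ((C 1 + C (-ν) * X) * f)) : AbsSummable f := by
  set g := (C 1 + C (-ν) * X) * f with hg
  have h0 : coeff 0 f = coeff 0 g := by rw [hg, coeff_zero_affine_mul, one_mul]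
  have hs : ∀ k, coeff (k + 1) f = coeff (k + 1) g + ν * coeff k f := by
    intro k; rw [hg, coeff_succ_affine_mul]; ring
  have hle : ∀ n, ∑ k ∈ Finset.range n, ‖coeff k f‖ ≤ (∑' k, ‖coeff k g‖) / (1 - ‖ν‖) := by
    intro n
    rw [le_div_iff₀ (by linarith)]
    have h1 : ∑ k ∈ Finset.range (n + 1), ‖coeff k f‖ ≤
        ∑ k ∈ Finset.range (n + 1), ‖coeff k g‖ + ‖ν‖ * ∑ k ∈ Finset.range n, ‖coeff k f‖ := by
      rw [Finset.sum_range_succ', Finset.sum_range_succ' (fun k => ‖coeff k g‖), h0,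
        Finset.mul_sum]
      have : ∑ k ∈ Finset.range n, ‖coeff (k + 1) f‖ ≤
          ∑ k ∈ Finset.range n, ‖coeff (k + 1) g‖ + ∑ k ∈ Finset.range n, ‖ν‖ * ‖coeff k f‖ := by
        rw [← Finset.sum_add_distrib]
        refine Finset.sum_le_sum fun k _ => ?_
        rw [hs, ← norm_mul]
        exact norm_add_le _ _
      linarith
    have h2 : ∑ k ∈ Finset.range (n + 1), ‖coeff k g‖ ≤ ∑' k, ‖coeff k g‖ :=
      Summable.sum_le_tsum _ (fun _ _ => norm_nonneg _) hf
    rw [Finset.sum_range_succ] at h1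
    have := norm_nonneg (coeff n f)
    linarith
  exact summable_of_sum_range_le (fun _ => norm_nonneg _) hle

lemma AbsSummable.summable_sq {f : PowerSeries ℂ} (hf : AbsSummable f) :
    Summable fun k => ‖coeff k f‖ ^ 2 := by
  refine Summable.of_norm_bounded_eventually_nat hf ?_
  filter_upwards [hf.tendsto_atTop_zero.eventually (gt_mem_nhds one_pos)] with k hk
  have := norm_nonneg (coeff k f)
  rw [Real.norm_of_nonneg (by positivity)]
  nlinarith

lemma absSummable_polynomial (p : Polynomial ℂ) : AbsSummable (p : PowerSeries ℂ) := by
  refine summable_of_hasFiniteSupport ((p.support.finite_toSet).subset fun k hk => ?_)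
  simpa using hk

lemma energy_nonneg (f : PowerSeries ℂ) : 0 ≤ energy f :=
  tsum_nonneg fun _ => by positivity

lemma AbsSummable.sq_coeff_zero_le {f : PowerSeries ℂ} (hf : AbsSummable f) :
    ‖coeff 0 f‖ ^ 2 ≤ energy f :=
  hf.summable_sq.le_tsum 0 fun _ _ => by positivity

lemma energy_one : energy 1 = 1 := by
  unfold energy
  rw [tsum_eq_single 0]
  · simp
  · intro k hk; simp [coeff_one, hk]

lemma AbsSummable.energy_eq {f : PowerSeries ℂ} (hf : AbsSummable f) :
    energy f = ‖coeff 0 f‖ ^ 2 + ∑' k, ‖coeff (k + 1) f‖ ^ 2 :=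
  hf.summable_sq.tsum_eq_zero_add

lemma norm_lag_le (x y : ℂ) : ‖x * conj y‖ ≤ (‖x‖ ^ 2 + ‖y‖ ^ 2) / 2 := by
  rw [norm_mul, RCLike.norm_conj]
  nlinarith [sq_nonneg (‖x‖ - ‖y‖)]

lemma AbsSummable.summable_lag {f : PowerSeries ℂ} (hf : AbsSummable f) :
    Summable fun k => coeff (k + 1) f * conj (coeff k f) := by
  refine Summable.of_norm_bounded
    (((((summable_nat_add_iff 1).2 hf.summable_sq)).add hf.summable_sq).div_const 2) fun k => ?_
  exact norm_lag_le _ _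

lemma AbsSummable.norm_lagCorr_le {f : PowerSeries ℂ} (hf : AbsSummable f) :
    ‖lagCorr f‖ ≤ energy f := by
  have hs1 := (summable_nat_add_iff 1).2 hf.summable_sq
  have h := tsum_of_norm_bounded (((hs1.add hf.summable_sq).div_const 2).hasSum)
    (f := fun k => coeff (k + 1) f * conj (coeff k f)) fun k => norm_lag_le _ _
  refine h.trans ?_
  rw [tsum_div_const, hs1.tsum_add hf.summable_sq]
  have h1 := hf.energy_eq
  have h2 : energy f = ∑' k, ‖coeff k f‖ ^ 2 := rfl
  have := sq_nonneg ‖coeff 0 f‖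
  linarith

/-- The factor matters only through ‖a‖² + ‖b‖² and a·conj b. This makes the reflection identity,
and the comparison of roots below, a matter of algebra in `energy f` and `lagCorr f`. -/
lemma AbsSummable.energy_affine_mul {f : PowerSeries ℂ} (hf : AbsSummable f) (a b : ℂ) :
    energy ((C a + C b * X) * f) =
      (‖a‖ ^ 2 + ‖b‖ ^ 2) * energy f + 2 * (a * conj b * lagCorr f).re := by
  rw [(hf.affine_mul a b).energy_eq, coeff_zero_affine_mul]
  simp only [coeff_succ_affine_mul]
  have hpt : ∀ x y : ℂ, ‖a * x + b * y‖ ^ 2 =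
      ‖a‖ ^ 2 * ‖x‖ ^ 2 + ‖b‖ ^ 2 * ‖y‖ ^ 2 + 2 * (a * conj b * (x * conj y)).re := by
    intro x y
    simp only [← Complex.normSq_eq_norm_sq, Complex.normSq_apply, Complex.add_re, Complex.add_im,
      Complex.mul_re, Complex.mul_im, Complex.conj_re, Complex.conj_im]
    ring
  simp only [hpt]
  have hs0 := hf.summable_sq
  have hs1 := (summable_nat_add_iff 1).2 hs0
  have hl := (hf.summable_lag.mul_left (a * conj b))
  have hre := Complex.hasSum_re hl.hasSum
  have htot := ((hs1.hasSum.mul_left (‖a‖ ^ 2)).add (hs0.hasSum.mul_left (‖b‖ ^ 2))).add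
    (hre.mul_left 2)
  rw [htot.tsum_eq, tsum_mul_left]
  have h1 := hf.energy_eq
  have h2 : energy f = ∑' k, ‖coeff k f‖ ^ 2 := rfl
  rw [norm_mul, mul_pow]
  change _ + (_ + _ * _ + 2 * (a * conj b * lagCorr f).re) = _
  rw [← h2]
  linear_combination -(‖a‖ ^ 2) * h1

/-- Reflecting the root of a linear factor in the unit circle preserves the energy. -/
lemma AbsSummable.energy_reflect {f : PowerSeries ℂ} (hf : AbsSummable f) (l : ℂ) :
    energy ((C 1 + C (-l) * X) * f) = energy ((C (conj l) + C (-1) * X) * f) := by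
  rw [hf.energy_affine_mul, hf.energy_affine_mul]
  simp [add_comm]

/-- The product of the factors `1 - l X`. -/
def linProd (s : Multiset ℂ) : PowerSeries ℂ := (s.map fun l => C 1 + C (-l) * X).prod

lemma linProd_cons (l : ℂ) (s : Multiset ℂ) :
    linProd (l ::ₘ s) = (C 1 + C (-l) * X) * linProd s := by
  simp [linProd]

lemma linProd_add (s t : Multiset ℂ) : linProd (s + t) = linProd s * linProd t := by
  simp [linProd]

lemma coeff_zero_linProd (s : Multiset ℂ) : coeff 0 (linProd s) = 1 := by
  induction s using Multiset.induction_on with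
  | empty => simp [linProd]
  | cons l s ih => rw [linProd_cons, coeff_zero_affine_mul, ih, one_mul]

lemma linProd_ne_zero (s : Multiset ℂ) : linProd s ≠ 0 := by
  intro h
  simpa [h] using coeff_zero_linProd s

lemma AbsSummable.linProd_mul {f : PowerSeries ℂ} (hf : AbsSummable f) (s : Multiset ℂ) :
    AbsSummable (linProd s * f) := by
  induction s using Multiset.induction_on with
  | empty => simpa [linProd] using hf
  | cons l s ih => rw [linProd_cons, mul_assoc]; exact ih.affine_mul _ _

lemma AbsSummable.of_linProd_mul {f : PowerSeries ℂ} {s : Multiset ℂ} (hs : ∀ l ∈ s, ‖l‖ < 1)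
    (hf : AbsSummable (linProd s * f)) : AbsSummable f := by
  induction s using Multiset.induction_on with
  | empty => simpa [linProd] using hf
  | cons l s ih =>
    rw [linProd_cons, mul_assoc] at hf
    exact ih (fun z hz => hs z (Multiset.mem_cons_of_mem hz))
      (hf.of_affine_mul (hs l (Multiset.mem_cons_self l s)))

/-- Reflecting every factor keeps the energy and collects the conj l in the constant coefficient,
whose squared modulus is one term of the energy. This is Jensen's inequality in elementary form. -/
lemma AbsSummable.le_energy_linProd_mul (s : Multiset ℂ) {f : PowerSeries ℂ}
    (hf : AbsSummable f) :
    (s.map fun l => ‖l‖).prod ^ 2 * ‖coeff 0 f‖ ^ 2 ≤ energy (linProd s * f) := by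
  induction s using Multiset.induction_on generalizing f with
  | empty => simpa [linProd] using hf.sq_coeff_zero_le
  | cons l s ih =>
    rw [linProd_cons, mul_assoc, (hf.linProd_mul s).energy_reflect, mul_left_comm]
    refine le_trans (le_of_eq ?_) (ih (hf.affine_mul (conj l) (-1)))
    rw [coeff_zero_affine_mul, norm_mul, RCLike.norm_conj, Multiset.map_cons, Multiset.prod_cons]
    ring

/-- Moving the root of a linear factor from outside the open unit disc to `ρ` times its reflection
in the unit circle costs at most the factor `(2 / (1 + ρ))²`. -/
lemma AbsSummable.energy_factor_le {g : PowerSeries ℂ} (hg : AbsSummable g) {l : ℂ} {ρ : ℝ}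
    (hl : 1 ≤ ‖l‖) (h0 : 0 < ρ) (h1 : ρ ≤ 1) :
    energy ((C 1 + C (-l) * X) * g) ≤
      (2 / (1 + ρ) * ‖l‖) ^ 2 * energy ((C 1 + C (-(ρ / conj l)) * X) * g) := by
  have hl0 : l ≠ 0 := by rintro rfl; simp at hl; linarith
  have hlp : 0 < ‖l‖ := by linarith
  rw [hg.energy_affine_mul, hg.energy_affine_mul]
  set a := energy g with ha
  set L := (conj l * lagCorr g).re with hL
  have hLle : |L| ≤ ‖l‖ * a := by
    refine (Complex.abs_re_le_norm _).trans ?_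
    rw [norm_mul, RCLike.norm_conj]
    exact mul_le_mul_of_nonneg_left hg.norm_lagCorr_le hlp.le
  have e1 : (1 * conj (-l) * lagCorr g).re = -L := by simp [hL]
  have e2 : (1 * conj (-(ρ / conj l : ℂ)) * lagCorr g).re = -(ρ / ‖l‖ ^ 2 * L) := by
    have : conj (-(ρ / conj l : ℂ)) = -((ρ / ‖l‖ ^ 2 : ℝ) : ℂ) * conj l := by
      have hc : (conj l : ℂ) ≠ 0 := by simpa using hl0
      have hll : ((‖l‖ : ℂ)) ^ 2 = l * conj l := (Complex.mul_conj' l).symm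
      push_cast
      rw [map_neg, map_div₀, Complex.conj_conj, Complex.conj_ofReal, hll]
      field_simp
    rw [this, one_mul, neg_mul, neg_mul, Complex.neg_re, mul_assoc, Complex.re_ofReal_mul]
  rw [e1, e2]
  have e3 : ‖-(ρ / conj l : ℂ)‖ = ρ / ‖l‖ := by
    rw [norm_neg, norm_div, RCLike.norm_conj, Complex.norm_real, Real.norm_of_nonneg h0.le]
  rw [e3, norm_one, norm_neg]
  set m := ‖l‖ with hm
  -- Right minus left is affine in L with slope 2(1-ρ)² ≥ 0, so the worst case is L = -m·a. There it
  -- reduces to (1+ρ)(1+m) ≤ 2(m+ρ), that is, (1-ρ)(m-1) ≥ 0.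
  have key : (1 + ρ) ^ 2 * ((1 + m ^ 2) * a - 2 * L) ≤
      4 * ((m ^ 2 + ρ ^ 2) * a - 2 * ρ * L) := by
    have ha0 : 0 ≤ a := energy_nonneg g
    have hL2 : -(m * a) ≤ L := (abs_le.1 hLle).1
    have hfac : 0 ≤ (1 - ρ) * (m - 1) := mul_nonneg (by linarith) (by linarith)
    have hsq : ((1 + ρ) * (1 + m)) ^ 2 ≤ (2 * (m + ρ)) ^ 2 :=
      pow_le_pow_left₀ (by positivity) (by nlinarith) 2
    nlinarith [mul_le_mul_of_nonneg_right hsq ha0,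
      mul_le_mul_of_nonneg_left hL2 (sq_nonneg (1 - ρ))]
  have hρ : 0 < (1 + ρ) ^ 2 := by positivity
  have : (2 / (1 + ρ) * m) ^ 2 * ((1 ^ 2 + (ρ / m) ^ 2) * a + 2 * -(ρ / m ^ 2 * L)) =
      4 * ((m ^ 2 + ρ ^ 2) * a - 2 * ρ * L) / (1 + ρ) ^ 2 := by
    field_simp
    ring
  rw [this, le_div_iff₀ hρ]
  linarith

lemma AbsSummable.energy_linProd_le (s : Multiset ℂ) {g : PowerSeries ℂ} {ρ : ℝ}
    (hg : AbsSummable g) (hs : ∀ l ∈ s, 1 ≤ ‖l‖) (h0 : 0 < ρ) (h1 : ρ ≤ 1) :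
    energy (linProd s * g) ≤ ((2 / (1 + ρ)) ^ Multiset.card s * (s.map fun l => ‖l‖).prod) ^ 2 *
      energy (linProd (s.map fun l => ρ / conj l) * g) := by
  induction s using Multiset.induction_on generalizing g with
  | empty => simp [linProd]
  | cons l s ih =>
    have hl := hs l (Multiset.mem_cons_self l s)
    have hs' : ∀ z ∈ s, 1 ≤ ‖z‖ := fun z hz => hs z (Multiset.mem_cons_of_mem hz)
    rw [linProd_cons, mul_assoc]
    refine ((hg.linProd_mul s).energy_factor_le hl h0 h1).trans ?_
    rw [mul_left_comm]
    refine (mul_le_mul_of_nonneg_left (ih (hg.affine_mul 1 (-(ρ / conj l))) hs')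
      (by positivity)).trans (le_of_eq ?_)
    rw [Multiset.map_cons (fun l => (ρ / conj l : ℂ)), linProd_cons, Multiset.map_cons,
      Multiset.prod_cons, Multiset.card_cons, pow_succ, mul_left_comm (linProd _), mul_assoc]
    ring_nf

end Series

/-! ### Impulse responses, characteristic polynomials and the return difference. -/

section Transfer

open Matrix PowerSeries

variable {ι R : Type*} [Fintype ι] [DecidableEq ι] [CommRing R]

/-- The impulse response `F Nᵗ G` as a power series. -/
def markovSeries (N : Matrix ι ι R) (G F : ι → R) : PowerSeries R :=
  PowerSeries.mk fun t => F ⬝ᵥ ((N ^ t) *ᵥ G)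

lemma coe_charpolyRev (M : Matrix ι ι R) :
    (M.charpolyRev : PowerSeries R) = (1 - (X : PowerSeries R) • M.map (C (R := R))).det := by
  rw [charpolyRev, ← Polynomial.coeToPowerSeries.ringHom_apply, RingHom.map_det]
  congr 1
  ext1 i j
  rcases eq_or_ne i j with h | h <;>
    simp [h, Polynomial.coeToPowerSeries.ringHom_apply] <;>
    exact mul_comm _ _

/-- The Neumann series, which needs no convergence for formal power series. -/
lemma one_sub_smul_mul_resolvent (N : Matrix ι ι R) :
    (1 - (X : PowerSeries R) • N.map (C (R := R))) *
      Matrix.of (fun i j => PowerSeries.mk fun t => (N ^ t) i j) = 1 := by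
  ext1 i j
  ext k
  rw [sub_mul, one_mul, Matrix.sub_apply, smul_mul, Matrix.smul_apply, smul_eq_mul, map_sub]
  cases k with
  | zero =>
    rcases eq_or_ne i j with h | h <;> simp [h, Matrix.one_apply]
  | succ k =>
    have h1 : (coeff (k + 1)) ((1 : Matrix ι ι (PowerSeries R)) i j) = 0 := by
      rw [Matrix.one_apply]
      split_ifs <;> simp [coeff_one]
    rw [h1, mul_comm, coeff_succ_mul_X, mul_apply, map_sum]
    simp only [map_apply, of_apply, coeff_C_mul, coeff_mk]
    rw [pow_succ', mul_apply, sub_self]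

/-- A rank-one feedback multiplies the reversed characteristic polynomial by the return
difference. -/
theorem charpolyRev_sub_vecMulVec (N : Matrix ι ι R) (G F : ι → R) :
    ((N - vecMulVec G F).charpolyRev : PowerSeries R) =
      (N.charpolyRev : PowerSeries R) * (1 + X * markovSeries N G F) := by
  set T : Matrix ι ι (PowerSeries R) := Matrix.of (fun i j => PowerSeries.mk fun t => (N ^ t) i j)
    with hT
  set G' : ι → PowerSeries R := fun i => C (G i)
  set F' : ι → PowerSeries R := fun i => C (F i)
  -- With 1 - X N factored out on the left, the rest is a rank-one perturbation of the identity, and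
  -- the matrix determinant lemma turns its determinant into a scalar.
  have hfac : (1 - (X : PowerSeries R) • (N - vecMulVec G F).map (C (R := R))) =
      (1 - (X : PowerSeries R) • N.map (C (R := R))) *
        (1 + replicateCol Unit (T *ᵥ ((X : PowerSeries R) • G')) * replicateRow Unit F') := by
    rw [mul_add, mul_one, ← vecMulVec_eq, mul_vecMulVec, mulVec_mulVec, hT,
      one_sub_smul_mul_resolvent, one_mulVec]
    ext1 i j
    simp [vecMulVec_apply, G', F']
    ring
  rw [coe_charpolyRev, coe_charpolyRev, hfac, det_mul, det_one_add_replicateCol_mul_replicateRow]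
  congr 2
  rw [mulVec_smul, dotProduct_smul, smul_eq_mul]
  congr 1
  ext t
  simp only [markovSeries, coeff_mk, dotProduct, map_sum, F', coeff_C_mul, mulVec, G', hT, of_apply,
    coeff_mul_C]

/-- Reversal turns each factor X - λ of the characteristic polynomial into 1 - λX; zero eigenvalues
become trivial factors. -/
lemma coe_charpolyRev_eq_linProd (A : Matrix ι ι ℝ) :
    ((A.map (algebraMap ℝ ℂ)).charpolyRev : PowerSeries ℂ) = linProd (eigs A) := by
  have h := (IsAlgClosed.splits (A.map (algebraMap ℝ ℂ)).charpoly).eq_prod_roots_of_monic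
    (charpoly_monic _)
  have hrev : ∀ s : Multiset ℂ, (((s.map fun a => Polynomial.X - Polynomial.C a).prod.reverse :
      Polynomial ℂ) : PowerSeries ℂ) = linProd s := by
    intro s
    induction s using Multiset.induction_on with
    | empty =>
      have : (1 : Polynomial ℂ).reverse = 1 := by
        simpa using Polynomial.reverse_C (1 : ℂ)
      simp [linProd, this]
    | cons l s ih =>
      have : (Polynomial.X - Polynomial.C l).reverse = 1 + Polynomial.C (-l) * Polynomial.X := by
        have h1 := Polynomial.reverse_add_C (Polynomial.X : Polynomial ℂ) (-l)
        have h2 : (Polynomial.X : Polynomial ℂ).reverse = 1 := by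
          simpa using (Polynomial.reverse_mul_X (1 : Polynomial ℂ)).trans
            (Polynomial.reverse_C (1 : ℂ))
        rw [h2, Polynomial.natDegree_X, pow_one] at h1
        rw [sub_eq_add_neg, ← Polynomial.C_neg, h1]
      rw [Multiset.map_cons, Multiset.prod_cons, Polynomial.reverse_mul_of_domain, linProd_cons,
        Polynomial.coe_mul, ih, this]
      simp
  rw [← reverse_charpoly, h, hrev]
  rfl

lemma markovSeries_map_coeff (N : Matrix ι ι ℝ) (G F : ι → ℝ) (t : ℕ) :
    coeff t (markovSeries (N.map (algebraMap ℝ ℂ)) (fun i => (G i : ℂ)) (fun i => (F i : ℂ))) =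
      ((F ⬝ᵥ ((N ^ t) *ᵥ G) : ℝ) : ℂ) := by
  have hp : (N.map (algebraMap ℝ ℂ)) ^ t = (N ^ t).map (algebraMap ℝ ℂ) :=
    (map_pow (algebraMap ℝ ℂ).mapMatrix N t).symm
  rw [markovSeries, coeff_mk, hp]
  simp [dotProduct, mulVec]

/-- The return difference `1 + ∑ F Nᵗ G X^(t+1)`. -/
def returnDiff (N : Matrix ι ι ℝ) (G F : ι → ℝ) : PowerSeries ℂ :=
  1 + X * markovSeries (N.map (algebraMap ℝ ℂ)) (fun i => (G i : ℂ)) (fun i => (F i : ℂ))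

/-- The bridge from spectra to impulse responses. In the applications N is the closed loop, and
subtracting the rank-one term opens it. -/
lemma linProd_mul_returnDiff (N : Matrix ι ι ℝ) (G F : ι → ℝ) :
    linProd (eigs N) * returnDiff N G F = linProd (eigs (N - vecMulVec G F)) := by
  rw [← coe_charpolyRev_eq_linProd, ← coe_charpolyRev_eq_linProd, returnDiff,
    ← charpolyRev_sub_vecMulVec]
  congr 2
  ext i j
  simp [vecMulVec_apply]

lemma coeff_zero_returnDiff (N : Matrix ι ι ℝ) (G F : ι → ℝ) :
    coeff 0 (returnDiff N G F) = 1 := by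
  simp [returnDiff]

lemma coeff_succ_returnDiff (N : Matrix ι ι ℝ) (G F : ι → ℝ) (t : ℕ) :
    coeff (t + 1) (returnDiff N G F) = ((F ⬝ᵥ ((N ^ t) *ᵥ G) : ℝ) : ℂ) := by
  rw [returnDiff, map_add, mul_comm, coeff_succ_mul_X, markovSeries_map_coeff]
  simp [coeff_one]

lemma absSummable_linProd (s : Multiset ℂ) : AbsSummable (linProd s) := by
  have h1 : AbsSummable 1 := by simpa using absSummable_polynomial 1
  simpa using h1.linProd_mul s

/-- Multiplied by the closed-loop factors the series is a polynomial, and division by factors with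
‖λ‖ < 1 keeps summability. This provides the decay of impulse responses without Jordan forms or the
spectral radius. -/
lemma SchurStable.absSummable_returnDiff {N : Matrix ι ι ℝ} (hN : SchurStable N) (G F : ι → ℝ) :
    AbsSummable (returnDiff N G F) := by
  refine AbsSummable.of_linProd_mul hN ?_
  rw [linProd_mul_returnDiff]
  exact absSummable_linProd _

lemma SchurStable.summable_abs {N : Matrix ι ι ℝ} (hN : SchurStable N) (G F : ι → ℝ) :
    Summable fun t => |F ⬝ᵥ ((N ^ t) *ᵥ G)| := by
  have h := (summable_nat_add_iff 1).2 (hN.absSummable_returnDiff G F)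
  simpa only [coeff_succ_returnDiff, Complex.norm_real, Real.norm_eq_abs] using h

lemma SchurStable.summable_sq {N : Matrix ι ι ℝ} (hN : SchurStable N) (G F : ι → ℝ) :
    Summable fun t => (F ⬝ᵥ ((N ^ t) *ᵥ G)) ^ 2 := by
  have h := (summable_nat_add_iff 1).2 (hN.absSummable_returnDiff G F).summable_sq
  simpa only [coeff_succ_returnDiff, Complex.norm_real, Real.norm_eq_abs, sq_abs] using h

lemma SchurStable.energy_returnDiff {N : Matrix ι ι ℝ} (hN : SchurStable N) (G F : ι → ℝ) :
    energy (returnDiff N G F) = 1 + ∑' t, (F ⬝ᵥ ((N ^ t) *ᵥ G)) ^ 2 := by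
  rw [(hN.absSummable_returnDiff G F).energy_eq, coeff_zero_returnDiff]
  simp only [coeff_succ_returnDiff, Complex.norm_real, Real.norm_eq_abs, sq_abs]
  simp

end Transfer

/-! ### Spectra of block matrices and realization of prescribed spectra. -/

section Spectrum

open Matrix PowerSeries ComplexConjugate

variable {ι κ : Type*} [Fintype ι] [DecidableEq ι] [Fintype κ] [DecidableEq κ]

lemma eigs_eq_roots_map (A : Matrix ι ι ℝ) :
    eigs A = (A.charpoly.map (algebraMap ℝ ℂ)).roots := by
  rw [eigs, charpoly_map]

lemma eigs_fromBlocks_zero₁₂ (A : Matrix ι ι ℝ) (C : Matrix κ ι ℝ) (D : Matrix κ κ ℝ) :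
    eigs (fromBlocks A 0 C D) = eigs A + eigs D := by
  rw [eigs_eq_roots_map, charpoly_fromBlocks_zero₁₂, Polynomial.map_mul, Polynomial.roots_mul,
    ← eigs_eq_roots_map, ← eigs_eq_roots_map]
  exact mul_ne_zero ((charpoly_monic A).map _).ne_zero ((charpoly_monic D).map _).ne_zero

lemma eigs_fromBlocks_zero₂₁ (A : Matrix ι ι ℝ) (B : Matrix ι κ ℝ) (D : Matrix κ κ ℝ) :
    eigs (fromBlocks A B 0 D) = eigs A + eigs D := by
  rw [eigs_eq_roots_map, charpoly_fromBlocks_zero₂₁, Polynomial.map_mul, Polynomial.roots_mul,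
    ← eigs_eq_roots_map, ← eigs_eq_roots_map]
  exact mul_ne_zero ((charpoly_monic A).map _).ne_zero ((charpoly_monic D).map _).ne_zero

lemma card_eigs (A : Matrix ι ι ℝ) : Multiset.card (eigs A) = Fintype.card ι := by
  rw [eigs, ← (IsAlgClosed.splits _).natDegree_eq_card_roots, charpoly_natDegree_eq_dim]

lemma eigs_map_conj (A : Matrix ι ι ℝ) : (eigs A).map conj = eigs A := by
  have h := (IsAlgClosed.splits (A.charpoly.map (algebraMap ℝ ℂ))).roots_map (starRingEnd ℂ)
  rw [eigs_eq_roots_map, ← h, Polynomial.map_map]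
  congr 2
  ext x
  simp

lemma map_conj_linProd (s : Multiset ℂ) :
    (linProd s).map (starRingEnd ℂ) = linProd (s.map conj) := by
  induction s using Multiset.induction_on with
  | empty => simp [linProd]
  | cons l s ih => rw [linProd_cons, map_mul, ih, Multiset.map_cons, linProd_cons]; simp

lemma coeff_linProd_eq_zero (s : Multiset ℂ) {k : ℕ} (hk : Multiset.card s < k) :
    coeff k (linProd s) = 0 := by
  induction s using Multiset.induction_on generalizing k with
  | empty =>
    have : k ≠ 0 := by simp at hk; omega
    simp [linProd, coeff_one, this]
  | cons l s ih =>
    obtain ⟨j, rfl⟩ : ∃ j, k = j + 1 := ⟨k - 1, by omega⟩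
    rw [Multiset.card_cons] at hk
    rw [linProd_cons, coeff_succ_affine_mul, ih (by omega), ih (by omega)]
    simp

/-- If z ∈ s had ‖z‖ ≥ 1, cancelling the other factors would make 1/(1 - zX) a polynomial divided by
`linProd t`, hence absolutely summable, although its coefficients z^k do not tend to zero. -/
lemma norm_lt_one_of_linProd_eq {s t : Multiset ℂ} (h : linProd s = linProd t)
    (ht : ∀ z ∈ t, ‖z‖ < 1) : ∀ z ∈ s, ‖z‖ < 1 := by
  intro z hz
  by_contra! hz1
  obtain ⟨s', rfl⟩ := Multiset.exists_cons_of_mem hz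
  have hc : constantCoeff (linProd t) ≠ 0 := by
    rw [← coeff_zero_eq_constantCoeff_apply, coeff_zero_linProd]; exact one_ne_zero
  have hg : AbsSummable (linProd t)⁻¹ := by
    refine AbsSummable.of_linProd_mul ht ?_
    rw [PowerSeries.mul_inv_cancel _ hc]
    simpa using absSummable_polynomial 1
  set f := linProd s' * (linProd t)⁻¹ with hf
  have hfs : AbsSummable f := hg.linProd_mul s'
  have h1 : (C 1 + C (-z) * X) * f = 1 := by
    rw [hf, ← mul_assoc, ← linProd_cons, h, PowerSeries.mul_inv_cancel _ hc]
  have hk : ∀ k, coeff k f = z ^ k := by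
    intro k
    induction k with
    | zero =>
      have := congrArg (coeff 0) h1
      rw [coeff_zero_affine_mul] at this
      simpa using this
    | succ k ih =>
      have := congrArg (coeff (k + 1)) h1
      rw [coeff_succ_affine_mul, ih, coeff_one, if_neg (Nat.succ_ne_zero k)] at this
      rw [pow_succ]
      linear_combination this
  have h0 := hfs.tendsto_atTop_zero
  have hlt := (h0.eventually (gt_mem_nhds one_pos)).exists
  obtain ⟨k, hk1⟩ := hlt
  rw [hk, norm_pow] at hk1
  exact absurd (one_le_pow₀ hz1) (not_le.2 hk1)

/-- The nilpotent lower shift. -/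
def lowerShift (n : ℕ) (R : Type*) [Zero R] [One R] : Matrix (Fin n) (Fin n) R :=
  Matrix.of fun i j => if i.val = j.val + 1 then 1 else 0

/-- The first unit vector. -/
def firstUnit (n : ℕ) : Fin n → ℝ := fun i => if i.val = 0 then 1 else 0

lemma lowerShift_pow_mulVec (n t : ℕ) :
    (lowerShift n ℝ ^ t) *ᵥ firstUnit n = fun i => if i.val = t then 1 else 0 := by
  induction t with
  | zero => rw [pow_zero, one_mulVec]; rfl
  | succ t ih =>
    rw [pow_succ', ← mulVec_mulVec, ih]
    ext i
    simp only [mulVec, dotProduct, lowerShift, of_apply, mul_ite, mul_one, mul_zero]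
    by_cases hi : i.val = t + 1
    · rw [if_pos hi, Finset.sum_eq_single ⟨t, by omega⟩]
      · simp [hi]
      · intro b _ hb
        rw [if_neg]
        intro h; exact hb (Fin.ext h)
      · simp
    · rw [if_neg hi]
      refine Finset.sum_eq_zero fun j _ => ?_
      split_ifs with h1 h2
      · omega
      · rfl
      · rfl

lemma charpolyRev_lowerShift (n : ℕ) (R : Type*) [CommRing R] :
    (lowerShift n R).charpolyRev = 1 := by
  rw [charpolyRev, det_of_isLowerTriangular]
  · refine Finset.prod_eq_one fun i _ => ?_
    simp [lowerShift]
  · intro i j hij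
    have hij' : i.val < j.val := hij
    have h1 : i ≠ j := fun h => by rw [h] at hij'; exact lt_irrefl _ hij'
    have h2 : ¬ i.val = j.val + 1 := by omega
    simp [lowerShift, h1, h2]

/-- Every conjugation-invariant multiset of `n` numbers is the spectrum of a rank-one
perturbation of the shift. -/
lemma exists_linProd_eigs_eq {n : ℕ} {s : Multiset ℂ} (hs : Multiset.card s = n)
    (hc : s.map conj = s) :
    ∃ a : Fin n → ℝ,
      linProd (eigs (lowerShift n ℝ - vecMulVec (firstUnit n) a)) = linProd s := by
  -- Invariance under conjugation makes the coefficients real, so they can serve as entries of a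
  -- real matrix.
  have hreal : ∀ k, ((coeff k (linProd s)).re : ℂ) = coeff k (linProd s) := by
    intro k
    have h := congrArg (coeff k) (map_conj_linProd s)
    rw [hc, coeff_map] at h
    exact Complex.conj_eq_iff_re.1 h
  -- The shift is nilpotent with reversed characteristic polynomial 1, and its powers move the first
  -- unit vector through the basis. The return difference of the perturbed matrix therefore inverts
  -- a polynomial with coefficients `a`; the product identity reads these off directly.
  refine ⟨fun i => (coeff (i.val + 1) (linProd s)).re, ?_⟩
  rw [← linProd_mul_returnDiff, ← coe_charpolyRev_eq_linProd]
  have h1 : (lowerShift n ℝ).map (algebraMap ℝ ℂ) = lowerShift n ℂ := by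
    ext i j
    simp [lowerShift, apply_ite]
  rw [h1, charpolyRev_lowerShift, Polynomial.coe_one, one_mul]
  ext k
  cases k with
  | zero => rw [coeff_zero_returnDiff, coeff_zero_linProd]
  | succ k =>
    rw [coeff_succ_returnDiff, lowerShift_pow_mulVec]
    simp only [dotProduct, mul_ite, mul_one, mul_zero]
    by_cases hk : k < n
    · rw [Finset.sum_eq_single ⟨k, hk⟩]
      · simp [hreal]
      · intro b _ hb
        rw [if_neg]
        intro h; exact hb (Fin.ext h)
      · simp
    · rw [coeff_linProd_eq_zero s (by omega), Finset.sum_eq_zero, Complex.ofReal_zero]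
      intro i _
      rw [if_neg]
      have := i.isLt
      omega

end Spectrum

/-! ### The least gain of an internally stabilizing controller. -/

section Gain

open Matrix PowerSeries ComplexConjugate

/-- The input direction of the loop. -/
def loopInput {n : ℕ} (B : Fin n → ℝ) (K : Controller n) : Fin n ⊕ Fin K.order → ℝ :=
  Sum.elim B 0

/-- The functional that reads the controller output off the loop state. -/
def loopOutput {n : ℕ} (K : Controller n) : Fin n ⊕ Fin K.order → ℝ := Sum.elim K.Dc K.Cc

/-- The impulse response of the nominal loop from the plant input to the controller output. -/
def impulse {n : ℕ} (A : Matrix (Fin n) (Fin n) ℝ) (B : Fin n → ℝ) (e : ℝ) (K : Controller n)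
    (t : ℕ) : ℝ :=
  loopOutput K ⬝ᵥ ((nominalMatrix A B K e ^ t) *ᵥ loopInput B K)

/-- The energy of the impulse response. -/
def gain {n : ℕ} (A : Matrix (Fin n) (Fin n) ℝ) (B : Fin n → ℝ) (e : ℝ) (K : Controller n) : ℝ :=
  ∑' t, impulse A B e K t ^ 2

variable {n : ℕ} (A : Matrix (Fin n) (Fin n) ℝ) (B : Fin n → ℝ) (e : ℝ)

/-- Opening the loop at the plant input leaves a block triangular matrix, so the open-loop spectrum
is that of the plant together with that of the controller. -/
lemma nominalMatrix_sub_feedback (K : Controller n) :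
    nominalMatrix A B K e - vecMulVec (loopInput B K) ((1 - e) • loopOutput K) =
      fromBlocks A 0 K.Bc K.Ac := by
  ext i j
  rcases i with i | i <;> rcases j with j | j <;>
    simp [nominalMatrix, loopInput, loopOutput, vecMulVec_apply]

/-- The stable part of the spectrum. -/
def stablePoles (A : Matrix (Fin n) (Fin n) ℝ) : Multiset ℂ :=
  (eigs A).filter fun z => ‖z‖ < 1

lemma unstablePoles_add_stablePoles : unstablePoles A + stablePoles A = eigs A := by
  classical
  conv_rhs => rw [← Multiset.filter_add_not (fun z : ℂ => 1 ≤ ‖z‖) (eigs A)]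
  rw [unstablePoles, stablePoles]
  congr 1
  congr 1
  ext z
  exact not_le.symm

lemma one_le_norm_of_mem_unstablePoles {z : ℂ} (hz : z ∈ unstablePoles A) : 1 ≤ ‖z‖ := by
  classical
  exact (Multiset.mem_filter.1 hz).2

lemma norm_lt_one_of_mem_stablePoles {z : ℂ} (hz : z ∈ stablePoles A) : ‖z‖ < 1 :=
  (Multiset.mem_filter.1 hz).2

lemma constantCoeff_linProd (s : Multiset ℂ) : constantCoeff (linProd s) = 1 := by
  rw [← coeff_zero_eq_constantCoeff_apply, coeff_zero_linProd]

lemma constantCoeff_linProd_ne_zero (s : Multiset ℂ) : constantCoeff (linProd s) ≠ 0 := by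
  rw [constantCoeff_linProd]
  exact one_ne_zero

/-- No stabilizing controller has a gain below the pole bound. -/
theorem poleProduct_sq_sub_one_le {K : Controller n} (hK : SchurStable (nominalMatrix A B K e)) :
    poleProduct A ^ 2 - 1 ≤ (1 - e) ^ 2 * gain A B e K := by
  set N := nominalMatrix A B K e
  set F := (1 - e) • loopOutput K
  set S := returnDiff N (loopInput B K) F
  have hS : linProd (eigs N) * S =
      linProd (unstablePoles A) * linProd (stablePoles A + eigs K.Ac) := by
    rw [linProd_mul_returnDiff, nominalMatrix_sub_feedback, eigs_fromBlocks_zero₁₂,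
      ← linProd_add, ← add_assoc, unstablePoles_add_stablePoles]
  -- The return difference without its unstable plant factors. Controller poles stay in the
  -- numerator, where they do no harm even if they are unstable.
  set f := linProd (stablePoles A + eigs K.Ac) * (linProd (eigs N))⁻¹ with hf
  have hinv : linProd (eigs N) * (linProd (eigs N))⁻¹ = 1 :=
    PowerSeries.mul_inv_cancel _ (constantCoeff_linProd_ne_zero _)
  have hfN : linProd (eigs N) * f = linProd (stablePoles A + eigs K.Ac) := by
    rw [hf, mul_left_comm, hinv, mul_one]
  have hfs : AbsSummable f := by
    refine AbsSummable.of_linProd_mul hK ?_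
    rw [hfN]
    exact absSummable_linProd _
  have hSf : S = linProd (unstablePoles A) * f := by
    refine mul_left_cancel₀ (linProd_ne_zero (eigs N)) ?_
    rw [hS, mul_left_comm, hfN]
  have hf0 : coeff 0 f = 1 := by
    have := congrArg constantCoeff hfN
    rw [map_mul, constantCoeff_linProd, constantCoeff_linProd, one_mul] at this
    rw [coeff_zero_eq_constantCoeff_apply, this]
  have h := hfs.le_energy_linProd_mul (unstablePoles A)
  rw [hf0, ← hSf, hK.energy_returnDiff, norm_one, one_pow, mul_one] at h
  have hg : ∑' t, (F ⬝ᵥ ((N ^ t) *ᵥ loopInput B K)) ^ 2 = (1 - e) ^ 2 * gain A B e K := by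
    rw [gain, ← tsum_mul_left]
    refine tsum_congr fun t => ?_
    simp only [F, impulse, smul_dotProduct, smul_eq_mul, mul_pow, N]
  rw [hg] at h
  change poleProduct A ^ 2 ≤ _ at h
  linarith

lemma poleProduct_of_unstablePoles_eq_zero (h : unstablePoles A = 0) : poleProduct A = 1 := by
  simp [poleProduct, h]

lemma one_le_poleProduct : 1 ≤ poleProduct A := by
  unfold poleProduct
  have : ∀ s : Multiset ℂ, (∀ z ∈ s, 1 ≤ ‖z‖) → 1 ≤ (s.map fun z => ‖z‖).prod := by
    intro s
    induction s using Multiset.induction_on with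
    | empty => simp
    | cons l s ih =>
      intro hs
      rw [Multiset.map_cons, Multiset.prod_cons]
      exact one_le_mul_of_one_le_of_one_le (hs l (Multiset.mem_cons_self l s))
        (ih fun z hz => hs z (Multiset.mem_cons_of_mem hz))
  exact this _ fun z hz => one_le_norm_of_mem_unstablePoles A hz

/-- Reflected unstable poles, shrunk by `ρ`, together with the stable poles. -/
def targetPoles (ρ : ℝ) : Multiset ℂ :=
  (unstablePoles A).map (fun l : ℂ => (ρ / conj l : ℂ)) + stablePoles A

lemma card_targetPoles (ρ : ℝ) : Multiset.card (targetPoles A ρ) = n := by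
  rw [targetPoles, Multiset.card_add, Multiset.card_map, ← Multiset.card_add,
    unstablePoles_add_stablePoles, card_eigs, Fintype.card_fin]

lemma unstablePoles_map_conj : (unstablePoles A).map conj = unstablePoles A := by
  classical
  conv_rhs => rw [unstablePoles, ← eigs_map_conj, Multiset.filter_map]
  rw [unstablePoles]
  congr 1
  exact Multiset.filter_congr fun z _ => by simp

lemma stablePoles_map_conj : (stablePoles A).map conj = stablePoles A := by
  conv_rhs => rw [stablePoles, ← eigs_map_conj, Multiset.filter_map]
  rw [stablePoles]
  congr 1
  exact Multiset.filter_congr fun z _ => by simp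

lemma targetPoles_map_conj (ρ : ℝ) : (targetPoles A ρ).map conj = targetPoles A ρ := by
  rw [targetPoles, Multiset.map_add, stablePoles_map_conj]
  congr 1
  nth_rewrite 2 [← unstablePoles_map_conj]
  rw [Multiset.map_map, Multiset.map_map]
  refine Multiset.map_congr rfl fun z _ => ?_
  simp

/-- A reflected pole has modulus ρ/‖l‖. Only a pole on the unit circle, which is its own reflection,
rules out ρ = 1. -/
lemma norm_lt_one_of_mem_targetPoles {ρ : ℝ} (h0 : 0 < ρ) (h1 : ρ ≤ 1)
    (hρ : ρ < 1 ∨ ∀ z ∈ eigs A, ‖z‖ ≠ 1) : ∀ z ∈ targetPoles A ρ, ‖z‖ < 1 := by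
  intro z hz
  rcases Multiset.mem_add.1 hz with hz | hz
  · obtain ⟨l, hl, rfl⟩ := Multiset.mem_map.1 hz
    have hl1 := one_le_norm_of_mem_unstablePoles A hl
    rw [norm_div, RCLike.norm_conj, Complex.norm_real, Real.norm_of_nonneg h0.le,
      div_lt_one (by linarith)]
    rcases hρ with hρ | hρ
    · linarith
    · refine lt_of_le_of_lt h1 (lt_of_le_of_ne hl1 (Ne.symm (hρ l ?_)))
      rw [← unstablePoles_add_stablePoles]
      exact Multiset.mem_add.2 (Or.inl hl)
  · exact norm_lt_one_of_mem_stablePoles A hz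

lemma pow_mulVec_of_semiconj {ι κ : Type*} [Fintype ι] [DecidableEq ι] [Fintype κ]
    [DecidableEq κ] {N : Matrix ι ι ℝ} {N' : Matrix κ κ ℝ} {T : Matrix κ ι ℝ}
    (h : T * N = N' * T) (v : ι → ℝ) (t : ℕ) :
    T *ᵥ ((N ^ t) *ᵥ v) = (N' ^ t) *ᵥ (T *ᵥ v) := by
  induction t with
  | zero => simp
  | succ t ih =>
    rw [pow_succ', pow_succ', ← mulVec_mulVec, ← mulVec_mulVec, ← ih, mulVec_mulVec, h,
      ← mulVec_mulVec]

/-- Serves the degenerate case B = 0, where stabilizability makes A itself stable and the plant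
input cannot be reconstructed from the state. -/
lemma gain_zero_controller (hA : SchurStable A) :
    ∃ K : Controller n, SchurStable (nominalMatrix A B K e) ∧ gain A B e K = 0 := by
  refine ⟨⟨0, 0, 0, 0, 0⟩, ?_, ?_⟩
  · have : nominalMatrix A B (⟨0, 0, 0, 0, 0⟩ : Controller n) e = fromBlocks A 0 0 0 := by
      ext i j
      rcases i with i | i <;> rcases j with j | j
      · simp [nominalMatrix]
      · exact j.elim0
      · exact i.elim0
      · exact i.elim0
    intro z hz
    rw [this, eigs_fromBlocks_zero₁₂] at hz
    rcases Multiset.mem_add.1 hz with hz | hz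
    · exact hA z hz
    · have := card_eigs (0 : Matrix (Fin 0) (Fin 0) ℝ)
      rw [Fintype.card_fin, Multiset.card_eq_zero] at this
      change z ∈ eigs (0 : Matrix (Fin 0) (Fin 0) ℝ) at hz
      rw [this] at hz
      simp at hz
  · have : loopOutput (⟨0, 0, 0, 0, 0⟩ : Controller n) = 0 := by
      ext i
      rcases i with i | i
      · simp [loopOutput]
      · exact i.elim0
    simp [gain, impulse, this]

variable {A B}

/-- The coordinate change η = ξ + Bq (b ⬝ᵥ x) turns the realizable controller state ξ into the
filter state η. The exogenous plant input is visible only in the next plant state, through b;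
subtracting Bq (b ⬝ᵥ x) from η makes the update causal. -/
lemma filterLoop_semiconj {F b : Fin n → ℝ} (hb : b ⬝ᵥ B = 1)
    (Aq : Matrix (Fin n) (Fin n) ℝ) (Bq Cq : Fin n → ℝ) :
    fromBlocks 1 0 (vecMulVec Bq b) 1 *
        fromBlocks (A + vecMulVec B (F + (Cq ⬝ᵥ Bq) • b)) (vecMulVec B Cq)
          ((Aq - vecMulVec Bq Cq) * vecMulVec Bq b - vecMulVec Bq b * (A + vecMulVec B F))
          (Aq - vecMulVec Bq Cq) =
      fromBlocks (A + vecMulVec B F) (vecMulVec B Cq) 0 Aq *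
        fromBlocks 1 0 (vecMulVec Bq b) 1 := by
  rw [fromBlocks_multiply, fromBlocks_multiply]
  simp only [one_mul, mul_one, zero_mul, mul_zero, add_zero, zero_add, vecMulVec_add,
    vecMulVec_smul, mul_add, sub_mul, vecMulVec_mul_vecMulVec, hb, one_smul, Matrix.mul_smul]
  congr 1
  · abel
  · abel
  · abel

/-- The controller that feeds back `F x + Cq η`, where `η` filters (state matrix `Aq`, input `Bq`)
the plant input, reconstructed from the state through `b` with `b ⬝ᵥ B = 1`. -/
lemma exists_filter_controller (he : e ≠ 1) {b : Fin n → ℝ} (hb : b ⬝ᵥ B = 1) (F : Fin n → ℝ)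
    (Aq : Matrix (Fin n) (Fin n) ℝ) (Bq Cq : Fin n → ℝ) :
    ∃ K : Controller n,
      eigs (nominalMatrix A B K e) =
        eigs (fromBlocks (A + vecMulVec B F) (vecMulVec B Cq) 0 Aq) ∧
      (1 - e) ^ 2 * gain A B e K = ∑' t, (Sum.elim F Cq ⬝ᵥ
        ((fromBlocks (A + vecMulVec B F) (vecMulVec B Cq) 0 Aq ^ t) *ᵥ Sum.elim B Bq)) ^ 2 := by
  have hc : (1 - e) ≠ 0 := sub_ne_zero.2 he.symm
  have hsemi := filterLoop_semiconj (A := A) (F := F) hb Aq Bq Cq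
  set N' := fromBlocks (A + vecMulVec B F) (vecMulVec B Cq) 0 Aq
  -- The factor (1 - e)⁻¹ in the output cancels the mean gain of the channel. The term (Cq ⬝ᵥ Bq) •
  -- b rewrites the output Cq η in terms of ξ and x.
  set K : Controller n := ⟨n, Aq - vecMulVec Bq Cq,
    (Aq - vecMulVec Bq Cq) * vecMulVec Bq b - vecMulVec Bq b * (A + vecMulVec B F),
    (1 - e)⁻¹ • Cq, (1 - e)⁻¹ • (F + (Cq ⬝ᵥ Bq) • b)⟩ with hK
  set T : Matrix (Fin n ⊕ Fin n) (Fin n ⊕ Fin n) ℝ := fromBlocks 1 0 (vecMulVec Bq b) 1 with hT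
  obtain ⟨N, hN⟩ : ∃ N : Matrix (Fin n ⊕ Fin n) (Fin n ⊕ Fin n) ℝ, N = nominalMatrix A B K e :=
    ⟨_, rfl⟩
  have hN' : N = fromBlocks (A + vecMulVec B (F + (Cq ⬝ᵥ Bq) • b)) (vecMulVec B Cq)
          ((Aq - vecMulVec Bq Cq) * vecMulVec Bq b - vecMulVec Bq b * (A + vecMulVec B F))
          (Aq - vecMulVec Bq Cq) := by
    rw [hN]
    change fromBlocks (A + (1 - e) • vecMulVec B ((1 - e)⁻¹ • (F + (Cq ⬝ᵥ Bq) • b)))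
      ((1 - e) • vecMulVec B ((1 - e)⁻¹ • Cq)) _ _ = _
    rw [vecMulVec_smul, smul_smul, mul_inv_cancel₀ hc, one_smul, vecMulVec_smul, smul_smul,
      mul_inv_cancel₀ hc, one_smul]
  rw [← hN'] at hsemi
  refine ⟨K, ?_, ?_⟩
  · rw [← hN]
    have hTu : IsUnit T := by
      rw [isUnit_iff_isUnit_det, hT, det_fromBlocks_zero₁₂]
      simp
    rw [eigs_eq_roots_map, eigs_eq_roots_map, ← charpoly_units_conj hTu.unit N, hTu.unit_spec,
      hsemi, mul_nonsing_inv_cancel_right _ _ ((isUnit_iff_isUnit_det T).1 hTu)]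
  · have himp : ∀ t, (1 - e) * impulse A B e K t =
        Sum.elim F Cq ⬝ᵥ ((N' ^ t) *ᵥ Sum.elim B Bq) := by
      intro t
      have h1 : T *ᵥ (Sum.elim B 0) = Sum.elim B Bq := by
        rw [hT, fromBlocks_mulVec]
        simp [vecMulVec_mulVec, hb]
      have h2 : Sum.elim F Cq ᵥ* T = Sum.elim (F + (Cq ⬝ᵥ Bq) • b) Cq := by
        rw [hT, vecMul_fromBlocks]
        simp [vecMul_vecMulVec]
      rw [← h1, ← pow_mulVec_of_semiconj hsemi, dotProduct_mulVec, h2, hN]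
      change (1 - e) * (Sum.elim ((1 - e)⁻¹ • (F + (Cq ⬝ᵥ Bq) • b)) ((1 - e)⁻¹ • Cq) ⬝ᵥ
        ((nominalMatrix A B K e ^ t : Matrix (Fin n ⊕ Fin n) (Fin n ⊕ Fin n) ℝ) *ᵥ
          Sum.elim B 0)) = _
      have h3 : Sum.elim ((1 - e)⁻¹ • (F + (Cq ⬝ᵥ Bq) • b)) ((1 - e)⁻¹ • Cq) =
          (1 - e)⁻¹ • (Sum.elim (F + (Cq ⬝ᵥ Bq) • b) Cq) := by
        ext i
        rcases i with i | i <;> rfl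
      rw [h3, smul_dotProduct, smul_eq_mul, mul_inv_cancel_left₀ hc]
    rw [gain, ← tsum_mul_left]
    refine tsum_congr fun t => ?_
    rw [← himp, mul_pow]

/-- The pole bound is attained up to the factor `(2 / (1 + ρ)) ^ m` of `poleProduct A`. -/
theorem exists_controller_gain_le (hAB : Stabilizable A B) (he : e ≠ 1) {ρ : ℝ} (h0 : 0 < ρ)
    (h1 : ρ ≤ 1) (hρ : ρ < 1 ∨ ∀ z ∈ eigs A, ‖z‖ ≠ 1) :
    ∃ K : Controller n, SchurStable (nominalMatrix A B K e) ∧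
      (1 - e) ^ 2 * gain A B e K ≤
        ((2 / (1 + ρ)) ^ Multiset.card (unstablePoles A) * poleProduct A) ^ 2 - 1 := by
  obtain ⟨F, hF⟩ := hAB
  by_cases hB : B = 0
  · have hA : SchurStable A := by simpa [hB] using hF
    obtain ⟨K, hK, hg⟩ := gain_zero_controller A B e hA
    refine ⟨K, hK, ?_⟩
    have hU : unstablePoles A = 0 := by
      rw [Multiset.eq_zero_iff_forall_notMem]
      intro z hz
      have h2 : z ∈ eigs A := by
        rw [← unstablePoles_add_stablePoles]
        exact Multiset.mem_add.2 (Or.inl hz)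
      exact absurd (hA z h2) (not_lt.2 (one_le_norm_of_mem_unstablePoles A hz))
    rw [hg, poleProduct_of_unstablePoles_eq_zero A hU, hU]
    simp
  have hBB : B ⬝ᵥ B ≠ 0 := fun h => hB (dotProduct_self_eq_zero.1 h)
  have hb : ((B ⬝ᵥ B)⁻¹ • B) ⬝ᵥ B = 1 := by
    rw [smul_dotProduct, smul_eq_mul, inv_mul_cancel₀ hBB]
  -- `a` gives the filter the target poles, and `a₀` encodes the spectrum of A + BF. With filter
  -- output a₀ - a, opening the loop replaces `a` by `a₀`, so the factors of A + BF occur in both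
  -- the open and the closed loop. They cancel, and S is the plant polynomial over the target
  -- polynomial.
  obtain ⟨a, ha⟩ := exists_linProd_eigs_eq (card_targetPoles A ρ) (targetPoles_map_conj A ρ)
  obtain ⟨a₀, ha₀⟩ := exists_linProd_eigs_eq (s := eigs (A + vecMulVec B F))
    (by rw [card_eigs, Fintype.card_fin]) (eigs_map_conj _)
  set Aq := lowerShift n ℝ - vecMulVec (firstUnit n) a
  obtain ⟨K, hK, hg⟩ := exists_filter_controller (A := A) e he hb F Aq (firstUnit n) (a₀ - a)
  set N' := fromBlocks (A + vecMulVec B F) (vecMulVec B (a₀ - a)) 0 Aq with hN'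
  have heN : eigs N' = eigs (A + vecMulVec B F) + eigs Aq := eigs_fromBlocks_zero₂₁ _ _ _
  have hAq : SchurStable Aq :=
    norm_lt_one_of_linProd_eq ha (norm_lt_one_of_mem_targetPoles A h0 h1 hρ)
  have hNs : SchurStable N' := by
    intro z hz
    rw [heN] at hz
    rcases Multiset.mem_add.1 hz with hz | hz
    · exact hF z hz
    · exact hAq z hz
  refine ⟨K, fun z hz => hNs z (hK ▸ hz), ?_⟩
  set S := returnDiff N' (Sum.elim B (firstUnit n)) (Sum.elim F (a₀ - a)) with hS
  have hopen : N' - vecMulVec (Sum.elim B (firstUnit n)) (Sum.elim F (a₀ - a)) =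
      fromBlocks A 0 (-vecMulVec (firstUnit n) F)
        (lowerShift n ℝ - vecMulVec (firstUnit n) a₀) := by
    ext i j
    rcases i with i | i <;> rcases j with j | j <;> simp [hN', Aq, vecMulVec_apply]
    ring
  have hprod : linProd (targetPoles A ρ) * S = linProd (eigs A) := by
    have h := linProd_mul_returnDiff N' (Sum.elim B (firstUnit n)) (Sum.elim F (a₀ - a))
    rw [hopen, eigs_fromBlocks_zero₁₂, heN, linProd_add, linProd_add, ha, ha₀, ← hS] at h
    refine mul_left_cancel₀ (linProd_ne_zero (eigs (A + vecMulVec B F))) ?_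
    rw [← mul_assoc, h, mul_comm]
  set U' := (unstablePoles A).map (fun l : ℂ => (ρ / conj l : ℂ)) with hU'
  have hSU : linProd U' * S = linProd (unstablePoles A) := by
    rw [targetPoles, ← unstablePoles_add_stablePoles A, linProd_add, linProd_add] at hprod
    refine mul_right_cancel₀ (linProd_ne_zero (stablePoles A)) ?_
    rw [← hprod]
    ring
  set f := (linProd U')⁻¹ with hf
  have hinv : linProd U' * f = 1 :=
    PowerSeries.mul_inv_cancel _ (constantCoeff_linProd_ne_zero _)
  have hfs : AbsSummable f := by
    refine AbsSummable.of_linProd_mul (s := U') (fun z hz =>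
      norm_lt_one_of_mem_targetPoles A h0 h1 hρ z (Multiset.mem_add.2 (Or.inl hz))) ?_
    rw [hinv]
    simpa using absSummable_polynomial 1
  have hSf : S = linProd (unstablePoles A) * f := by
    rw [← hSU, mul_right_comm, hinv, one_mul]
  -- Applied to f, the inverse of the moved factors: these cancel, so the energy on the right is
  -- that of the series 1.
  have hle := hfs.energy_linProd_le (unstablePoles A)
    (fun l hl => one_le_norm_of_mem_unstablePoles A hl) h0 h1
  rw [← hSf, ← hU', hinv, energy_one, mul_one, hS, hNs.energy_returnDiff] at hle
  rw [hg]
  change _ ≤ ((2 / (1 + ρ)) ^ Multiset.card (unstablePoles A) * poleProduct A) ^ 2 at hle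
  linarith

end Gain

/-! ### Discrete renewal equations. -/

section Renewal

variable {g : ℕ → ℝ} {s : ℝ}

/-- A subsolution of the renewal equation with kernel `s g` of mass less than one is bounded. -/
lemma renewal_bound (hg : ∀ t, 0 ≤ g t) (hgs : Summable g) (hs : 0 ≤ s)
    (hα : s * ∑' t, g t < 1) {c : ℝ} (hc : 0 ≤ c) {V : ℕ → ℝ}
    (hV : ∀ k, V k ≤ ∑ j ∈ Finset.range k, g (k - 1 - j) * (c + s * V j)) (k : ℕ) :
    V k ≤ (∑' t, g t) * c / (1 - s * ∑' t, g t) := by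
  set α := ∑' t, g t with hαd
  have hα0 : 0 ≤ α := tsum_nonneg hg
  have hd : 0 < 1 - s * α := by linarith
  set M := α * c / (1 - s * α) with hM
  have hM0 : 0 ≤ M := by positivity
  -- M is the constant solution for the full kernel mass; truncated kernels have less mass, so the
  -- bound passes along the strong induction.
  have hfix : α * (c + s * M) = M := by
    have hM' : M * (1 - s * α) = α * c := div_mul_cancel₀ _ hd.ne'
    linear_combination -hM'
  induction k using Nat.strong_induction_on with
  | _ k ih =>
    calc V k ≤ ∑ j ∈ Finset.range k, g (k - 1 - j) * (c + s * V j) := hV k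
      _ ≤ ∑ j ∈ Finset.range k, g (k - 1 - j) * (c + s * M) := by
          refine Finset.sum_le_sum fun j hj => mul_le_mul_of_nonneg_left ?_ (hg _)
          have := mul_le_mul_of_nonneg_left (ih j (Finset.mem_range.1 hj)) hs
          linarith
      _ = (∑ j ∈ Finset.range k, g j) * (c + s * M) := by
          rw [← Finset.sum_mul, Finset.sum_range_reflect]
      _ ≤ α * (c + s * M) := by
          refine mul_le_mul_of_nonneg_right (hgs.sum_le_tsum _ fun _ _ => hg _) (by positivity)
      _ = M := hfix

lemma sum_shifted_le (hg : ∀ t, 0 ≤ g t) (hgs : Summable g) (j m : ℕ) :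
    ∑ k ∈ Finset.range m, (if j < k then g (k - 1 - j) else 0) ≤ ∑' t, g t := by
  have : ∑ k ∈ Finset.range m, (if j < k then g (k - 1 - j) else 0) =
      ∑ i ∈ Finset.range (m - 1 - j), g i := by
    induction m with
    | zero => simp
    | succ m ih =>
      rw [Finset.sum_range_succ, ih]
      by_cases hj : j < m
      · rw [if_pos hj, show m + 1 - 1 - j = (m - 1 - j) + 1 by omega, Finset.sum_range_succ]
      · rw [if_neg hj, show m + 1 - 1 - j = m - 1 - j by omega, add_zero]
  rw [this]
  exact hgs.sum_le_tsum _ fun _ _ => hg _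

/-- A subsolution of the renewal equation with summable forcing is summable, with a bound. -/
lemma sum_renewal_le (hg : ∀ t, 0 ≤ g t) (hgs : Summable g) (hs : 0 ≤ s)
    (hα : s * ∑' t, g t < 1) {γ v : ℕ → ℝ} (hγ : ∀ k, 0 ≤ γ k) (hγs : Summable γ)
    (hv : ∀ k, 0 ≤ v k)
    (hle : ∀ k, v k ≤ γ k + ∑ j ∈ Finset.range k, g (k - 1 - j) * (s * v j)) (m : ℕ) :
    ∑ k ∈ Finset.range m, v k ≤ (∑' k, γ k) / (1 - s * ∑' t, g t) := by
  rw [le_div_iff₀ (by linarith)]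
  have h1 : ∑ k ∈ Finset.range m, ∑ j ∈ Finset.range k, g (k - 1 - j) * (s * v j) ≤
      (∑' t, g t) * (s * ∑ j ∈ Finset.range m, v j) := by
    calc ∑ k ∈ Finset.range m, ∑ j ∈ Finset.range k, g (k - 1 - j) * (s * v j)
        = ∑ k ∈ Finset.range m, ∑ j ∈ Finset.range m,
            (if j < k then g (k - 1 - j) else 0) * (s * v j) := by
          refine Finset.sum_congr rfl fun k hk => ?_
          have hk' := Finset.mem_range.1 hk
          rw [← Finset.sum_subset (Finset.range_subset_range.2 hk'.le)]
          · refine Finset.sum_congr rfl fun j hj => ?_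
            rw [if_pos (Finset.mem_range.1 hj)]
          · intro j _ hj
            rw [if_neg (by simpa using hj), zero_mul]
      _ = ∑ j ∈ Finset.range m,
            (∑ k ∈ Finset.range m, (if j < k then g (k - 1 - j) else 0)) * (s * v j) := by
          rw [Finset.sum_comm]
          exact Finset.sum_congr rfl fun j _ => (Finset.sum_mul _ _ _).symm
      _ ≤ ∑ j ∈ Finset.range m, (∑' t, g t) * (s * v j) :=
          Finset.sum_le_sum fun j _ =>
            mul_le_mul_of_nonneg_right (sum_shifted_le hg hgs j m) (mul_nonneg hs (hv j))
      _ = _ := by rw [← Finset.mul_sum, ← Finset.mul_sum]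
  have h2 : ∑ k ∈ Finset.range m, v k ≤ ∑ k ∈ Finset.range m, γ k +
      ∑ k ∈ Finset.range m, ∑ j ∈ Finset.range k, g (k - 1 - j) * (s * v j) := by
    rw [← Finset.sum_add_distrib]
    exact Finset.sum_le_sum fun k _ => hle k
  have h3 : ∑ k ∈ Finset.range m, γ k ≤ ∑' k, γ k := hγs.sum_le_tsum _ fun _ _ => hγ _
  linarith

/-- A bounded solution of the renewal equation forces the kernel mass below one and converges. -/
lemma renewal_tendsto (hg : ∀ t, 0 ≤ g t) (hgs : Summable g) (hs : 0 ≤ s) {U : ℕ → ℝ}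
    (hU : ∀ k, U k = ∑ j ∈ Finset.range k, g (k - 1 - j) * (1 + s * U j)) {C : ℝ}
    (hC : ∀ k, U k ≤ C) :
    s * ∑' t, g t < 1 ∧
      Tendsto U atTop (𝓝 ((∑' t, g t) / (1 - s * ∑' t, g t))) := by
  have hU0 : ∀ k, 0 ≤ U k := by
    intro k
    induction k using Nat.strong_induction_on with
    | _ k ih =>
      rw [hU]
      refine Finset.sum_nonneg fun j hj => mul_nonneg (hg _) ?_
      have := mul_nonneg hs (ih j (Finset.mem_range.1 hj))
      linarith
  have hU' : ∀ k, U k = ∑ j ∈ Finset.range k, g j * (1 + s * U (k - 1 - j)) := by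
    intro k
    rw [hU, ← Finset.sum_range_reflect]
    refine Finset.sum_congr rfl fun j hj => ?_
    have := Finset.mem_range.1 hj
    rw [show k - 1 - (k - 1 - j) = j by omega]
  -- Going from k to k + 1 adds a nonnegative term and, by induction, increases each of the others.
  -- Monotone and bounded, U converges.
  have hmono : Monotone U := by
    refine monotone_nat_of_le_succ fun k => ?_
    induction k using Nat.strong_induction_on with
    | _ k ih =>
      rw [hU' k, hU' (k + 1), Finset.sum_range_succ]
      refine le_add_of_le_of_nonneg (Finset.sum_le_sum fun j hj => ?_)
        (mul_nonneg (hg _) (by have := mul_nonneg hs (hU0 (k + 1 - 1 - k)); linarith))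
      have hj' := Finset.mem_range.1 hj
      have h := ih (k - 1 - j) (by omega)
      rw [show k - 1 - j + 1 = k + 1 - 1 - j by omega] at h
      refine mul_le_mul_of_nonneg_left ?_ (hg _)
      have := mul_le_mul_of_nonneg_left h hs
      linarith
  obtain ⟨L, hL⟩ : ∃ L, Tendsto U atTop (𝓝 L) :=
    ⟨_, tendsto_atTop_ciSup hmono ⟨C, by rintro _ ⟨k, rfl⟩; exact hC k⟩⟩
  have hlim : Tendsto U atTop (𝓝 (∑' j, g j * (1 + s * L))) := by
    have h : ∀ k, U k = ∑' j, if j < k then g j * (1 + s * U (k - 1 - j)) else 0 := by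
      intro k
      rw [hU' k, tsum_eq_sum (s := Finset.range k)]
      · exact Finset.sum_congr rfl fun j hj => (if_pos (Finset.mem_range.1 hj)).symm
      · intro j hj
        rw [if_neg (by simpa using hj)]
    rw [show U = fun k => ∑' j, if j < k then g j * (1 + s * U (k - 1 - j)) else 0 from funext h]
    refine tendsto_tsum_of_dominated_convergence (bound := fun j => g j * (1 + s * C))
      (hgs.mul_right _) (fun j => ?_) (Eventually.of_forall fun k j => ?_)
    · have h1 : Tendsto (fun k => U (k - 1 - j)) atTop (𝓝 L) := by
        refine hL.comp ?_
        rw [show (fun k => k - 1 - j) = fun k => k - (1 + j) by funext k; omega]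
        exact tendsto_sub_atTop_nat _
      refine ((((h1.const_mul s).const_add 1).const_mul (g j))).congr' ?_
      filter_upwards [eventually_gt_atTop j] with k hk
      rw [if_pos hk]
    · have hsC : 0 ≤ s * U (k - 1 - j) := mul_nonneg hs (hU0 _)
      have hle := mul_le_mul_of_nonneg_left (hC (k - 1 - j)) hs
      split_ifs
      · rw [Real.norm_of_nonneg (mul_nonneg (hg j) (by linarith))]
        exact mul_le_mul_of_nonneg_left (by linarith) (hg j)
      · rw [norm_zero]
        exact mul_nonneg (hg j) (by linarith)
  have hfix := tendsto_nhds_unique hL hlim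
  rw [tsum_mul_right] at hfix
  have hL0 : 0 ≤ L := ge_of_tendsto' hL hU0
  have hα0 : 0 ≤ ∑' t, g t := tsum_nonneg hg
  set α := ∑' t, g t
  -- The limit satisfies L = α + sαL. If sα ≥ 1, this forces α = 0, a contradiction.
  have hlt : s * α < 1 := by
    by_contra! hge
    have h1 : α * s * L ≥ L := by nlinarith
    have h2 : α = 0 := by nlinarith
    rw [h2] at hge
    linarith
  refine ⟨hlt, ?_⟩
  have : α / (1 - s * α) = L := by
    rw [div_eq_iff (by linarith)]
    linarith
  rwa [this]

end Renewal

/-! ### Independence, stationarity and existence of the noise. -/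

section Environment

variable {Ω : Type*} {θ w : ℕ → Ω → ℝ}

/-- Channel gains and inputs as a single family. -/
def noise (θ w : ℕ → Ω → ℝ) : ℕ ⊕ ℕ → Ω → ℝ := Sum.elim θ w

/-- The σ-algebra generated by the noise at the times in `S`. -/
@[reducible] def noiseAlg (θ w : ℕ → Ω → ℝ) (S : Set ℕ) : MeasurableSpace Ω :=
  ⨆ i ∈ {i : ℕ ⊕ ℕ | Sum.elim id id i ∈ S}, MeasurableSpace.comap (noise θ w i) inferInstance

lemma measurable_channel_noiseAlg {S : Set ℕ} {k : ℕ} (hk : k ∈ S) :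
    Measurable[noiseAlg θ w S] (θ k) := by
  have h : MeasurableSpace.comap (noise θ w (Sum.inl k)) inferInstance ≤ noiseAlg θ w S :=
    le_iSup₂_of_le (Sum.inl k) hk le_rfl
  exact Measurable.mono (comap_measurable _) h le_rfl

lemma measurable_input_noiseAlg {S : Set ℕ} {k : ℕ} (hk : k ∈ S) :
    Measurable[noiseAlg θ w S] (w k) := by
  have h : MeasurableSpace.comap (noise θ w (Sum.inr k)) inferInstance ≤ noiseAlg θ w S :=
    le_iSup₂_of_le (Sum.inr k) hk le_rfl
  exact Measurable.mono (comap_measurable _) h le_rfl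

lemma noiseAlg_mono {S T : Set ℕ} (h : S ⊆ T) : noiseAlg θ w S ≤ noiseAlg θ w T :=
  biSup_mono fun _ hi => h hi

variable [mΩ : MeasurableSpace Ω] {P : Measure Ω} {e : ℝ}

lemma IsEnvironment.measurable_noise (h : IsEnvironment P e θ w) (i : ℕ ⊕ ℕ) :
    Measurable (noise θ w i) := by
  rcases i with i | i
  · exact h.measurable_channel i
  · exact h.measurable_input i

lemma IsEnvironment.noiseAlg_le (h : IsEnvironment P e θ w) (S : Set ℕ) : noiseAlg θ w S ≤ mΩ :=
  iSup₂_le fun i _ => (h.measurable_noise i).comap_le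

/-- A finite rectangle splits into a channel part and an input part: independence of the two
processes separates these, and independence within each process does the rest. -/
lemma IsEnvironment.iIndepFun_noise [IsProbabilityMeasure P] (h : IsEnvironment P e θ w) :
    iIndepFun (noise θ w) P := by
  rw [iIndepFun_iff_measure_inter_preimage_eq_mul]
  intro S s hs
  have hl : MeasurableSet {x : ℕ → ℝ | ∀ k ∈ S.toLeft, x k ∈ s (Sum.inl k)} := by
    have : {x : ℕ → ℝ | ∀ k ∈ S.toLeft, x k ∈ s (Sum.inl k)} =
        ⋂ k ∈ S.toLeft, (fun x : ℕ → ℝ => x k) ⁻¹' s (Sum.inl k) := by ext; simp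
    rw [this]
    exact Finset.measurableSet_biInter _ fun k hk =>
      measurable_pi_apply k (hs _ (Finset.mem_toLeft.1 hk))
  have hr : MeasurableSet {x : ℕ → ℝ | ∀ k ∈ S.toRight, x k ∈ s (Sum.inr k)} := by
    have : {x : ℕ → ℝ | ∀ k ∈ S.toRight, x k ∈ s (Sum.inr k)} =
        ⋂ k ∈ S.toRight, (fun x : ℕ → ℝ => x k) ⁻¹' s (Sum.inr k) := by ext; simp
    rw [this]
    exact Finset.measurableSet_biInter _ fun k hk =>
      measurable_pi_apply k (hs _ (Finset.mem_toRight.1 hk))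
  have hset : ⋂ i ∈ S, noise θ w i ⁻¹' s i =
      (fun ω k => w k ω) ⁻¹' {x : ℕ → ℝ | ∀ k ∈ S.toRight, x k ∈ s (Sum.inr k)} ∩
      (fun ω k => θ k ω) ⁻¹' {x : ℕ → ℝ | ∀ k ∈ S.toLeft, x k ∈ s (Sum.inl k)} := by
    ext ω
    simp [noise, and_comm]
  have h1 : (fun ω k => θ k ω) ⁻¹' {x : ℕ → ℝ | ∀ k ∈ S.toLeft, x k ∈ s (Sum.inl k)} =
      ⋂ k ∈ S.toLeft, θ k ⁻¹' s (Sum.inl k) := by ext; simp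
  have h2 : (fun ω k => w k ω) ⁻¹' {x : ℕ → ℝ | ∀ k ∈ S.toRight, x k ∈ s (Sum.inr k)} =
      ⋂ k ∈ S.toRight, w k ⁻¹' s (Sum.inr k) := by ext; simp
  rw [hset, indepFun_iff_measure_inter_preimage_eq_mul.1 h.indep_input_channel _ _ hr hl, h1, h2,
    h.indep_channel.measure_inter_preimage_eq_mul _ fun k hk => hs _ (Finset.mem_toLeft.1 hk),
    h.indep_input.measure_inter_preimage_eq_mul _ fun k hk => hs _ (Finset.mem_toRight.1 hk)]
  conv_rhs => rw [← Finset.toLeft_disjSum_toRight (u := S), Finset.prod_disjSum]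
  rw [mul_comm]
  rfl

lemma IsEnvironment.indep_noiseAlg [IsProbabilityMeasure P] (h : IsEnvironment P e θ w)
    {S T : Set ℕ} (hST : Disjoint S T) : Indep (noiseAlg θ w S) (noiseAlg θ w T) P := by
  refine indep_iSup_of_disjoint (fun i => (h.measurable_noise i).comap_le)
    ((iIndepFun_iff_iIndep _ _ _).1 h.iIndepFun_noise) ?_
  rw [Set.disjoint_left] at hST ⊢
  exact fun i hi hi' => hST hi hi'

lemma IsEnvironment.indepFun_of_disjoint [IsProbabilityMeasure P] (h : IsEnvironment P e θ w)
    {S T : Set ℕ} (hST : Disjoint S T) {f g : Ω → ℝ} (hf : Measurable[noiseAlg θ w S] f)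
    (hg : Measurable[noiseAlg θ w T] g) : IndepFun f g P := by
  rw [IndepFun_iff_Indep]
  exact indep_of_indep_of_le (h.indep_noiseAlg hST) hf.comap_le hg.comap_le

lemma IsEnvironment.integral_mul [IsProbabilityMeasure P] (h : IsEnvironment P e θ w)
    {S T : Set ℕ} (hST : Disjoint S T) {f g : Ω → ℝ} (hf : Measurable[noiseAlg θ w S] f)
    (hg : Measurable[noiseAlg θ w T] g) :
    ∫ ω, f ω * g ω ∂P = (∫ ω, f ω ∂P) * ∫ ω, g ω ∂P :=
  (h.indepFun_of_disjoint hST hf hg).integral_fun_mul_eq_mul_integral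
    (hf.mono (h.noiseAlg_le S) le_rfl).aestronglyMeasurable
    (hg.mono (h.noiseAlg_le T) le_rfl).aestronglyMeasurable

lemma IsEnvironment.channel_ae [IsProbabilityMeasure P] (h : IsEnvironment P e θ w)
    (he0 : 0 ≤ e) (he1 : e ≤ 1) (k : ℕ) : ∀ᵐ ω ∂P, θ k ω = 0 ∨ θ k ω = 1 := by
  have hm := h.measurable_channel k
  have m0 : MeasurableSet {ω | θ k ω = 0} := hm (measurableSet_singleton 0)
  have m1 : MeasurableSet {ω | θ k ω = 1} := hm (measurableSet_singleton 1)
  have hd : Disjoint {ω | θ k ω = 0} {ω | θ k ω = 1} := by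
    rw [Set.disjoint_left]
    intro ω h0 h1
    simp only [Set.mem_ofPred_eq] at h0 h1
    rw [h0] at h1
    exact zero_ne_one h1
  have hu : P ({ω | θ k ω = 0} ∪ {ω | θ k ω = 1}) = 1 := by
    rw [measure_union hd m1, h.prob_erased, h.prob_received, ← ENNReal.ofReal_add he0 (by linarith)]
    simp
  exact (prob_compl_eq_zero_iff (m0.union m1)).2 hu

lemma IsEnvironment.integral_channel [IsProbabilityMeasure P] (h : IsEnvironment P e θ w)
    (he0 : 0 ≤ e) (he1 : e ≤ 1) (k : ℕ) (φ : ℝ → ℝ) :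
    ∫ ω, φ (θ k ω) ∂P = e * φ 0 + (1 - e) * φ 1 := by
  have hm := h.measurable_channel k
  have m0 : MeasurableSet {ω | θ k ω = 0} := hm (measurableSet_singleton 0)
  have m1 : MeasurableSet {ω | θ k ω = 1} := hm (measurableSet_singleton 1)
  have hae : (fun ω => φ (θ k ω)) =ᵐ[P] fun ω =>
      {ω | θ k ω = 0}.indicator (fun _ => φ 0) ω + {ω | θ k ω = 1}.indicator (fun _ => φ 1) ω := by
    filter_upwards [h.channel_ae he0 he1 k] with ω hω
    rcases hω with hω | hω <;> simp [hω, Set.indicator]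
  rw [integral_congr_ae hae, integral_add ((integrable_const _).indicator m0)
    ((integrable_const _).indicator m1), integral_indicator_const _ m0,
    integral_indicator_const _ m1]
  simp only [measureReal_def, h.prob_erased, h.prob_received, smul_eq_mul]
  rw [ENNReal.toReal_ofReal he0, ENNReal.toReal_ofReal (by linarith)]

/-- The two atoms have total mass one and so determine the law; in particular, the gains are
identically distributed. -/
lemma IsEnvironment.map_channel [IsProbabilityMeasure P] (h : IsEnvironment P e θ w)
    (he0 : 0 ≤ e) (he1 : e ≤ 1) (k : ℕ) :
    P.map (θ k) = ENNReal.ofReal e • Measure.dirac 0 + ENNReal.ofReal (1 - e) • Measure.dirac 1 := by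
  have hm := h.measurable_channel k
  ext s hs
  rw [Measure.map_apply hm hs]
  have hd : Disjoint {ω | θ k ω = 0 ∧ (0 : ℝ) ∈ s} {ω | θ k ω = 1 ∧ (1 : ℝ) ∈ s} := by
    rw [Set.disjoint_left]
    rintro ω ⟨h0, _⟩ ⟨h1, _⟩
    rw [h0] at h1
    exact zero_ne_one h1
  have hae : θ k ⁻¹' s =ᵐ[P] ({ω | θ k ω = 0 ∧ (0 : ℝ) ∈ s} ∪ {ω | θ k ω = 1 ∧ (1 : ℝ) ∈ s} :
      Set Ω) := by
    filter_upwards [h.channel_ae he0 he1 k] with ω hω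
    apply propext
    change θ k ω ∈ s ↔ (θ k ω = 0 ∧ (0 : ℝ) ∈ s) ∨ (θ k ω = 1 ∧ (1 : ℝ) ∈ s)
    rcases hω with hω | hω <;> simp [hω]
  have m1 : MeasurableSet {ω | θ k ω = 1 ∧ (1 : ℝ) ∈ s} :=
    (hm (measurableSet_singleton 1)).inter (MeasurableSet.const _)
  rw [measure_congr hae, measure_union hd m1]
  by_cases h0 : (0 : ℝ) ∈ s <;> by_cases h1 : (1 : ℝ) ∈ s <;>
    simp [h0, h1, h.prob_erased, h.prob_received, hs]

/-- The joint law of the noise is invariant under time shifts. -/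
lemma IsEnvironment.identDistrib_shift [IsProbabilityMeasure P] (h : IsEnvironment P e θ w)
    (he0 : 0 ≤ e) (he1 : e ≤ 1) (i : ℕ) :
    IdentDistrib (fun ω (l : ℕ ⊕ ℕ) => noise θ w (Sum.map (· + i) (· + i) l) ω)
      (fun ω l => noise θ w l ω) P P := by
  have hinj : Function.Injective (Sum.map (· + i) (· + i) : ℕ ⊕ ℕ → ℕ ⊕ ℕ) :=
    (add_left_injective i).sumMap (add_left_injective i)
  have hi := h.iIndepFun_noise.precomp hinj
  refine ⟨(measurable_pi_iff.2 fun l => h.measurable_noise _).aemeasurable,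
    (measurable_pi_iff.2 fun l => h.measurable_noise _).aemeasurable, ?_⟩
  -- Independence makes both laws infinite products, so comparing the marginals is enough.
  have h1 := hi.map_fun_eq_infinitePi_map fun l => h.measurable_noise _
  have h2 := h.iIndepFun_noise.map_fun_eq_infinitePi_map h.measurable_noise
  simp only at h1
  rw [h1, h2]
  congr 1
  funext l
  rcases l with l | l
  · exact (h.map_channel he0 he1 _).trans (h.map_channel he0 he1 _).symm
  · exact ((h.ident_input _).trans (h.ident_input _).symm).map_eq

/-- The law of a single channel gain. -/
def channelLaw (e : ℝ) : Measure ℝ :=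
  ENNReal.ofReal e • Measure.dirac 0 + ENNReal.ofReal (1 - e) • Measure.dirac 1

/-- An environment with standardized input exists. -/
lemma exists_environment (he0 : 0 ≤ e) (he1 : e ≤ 1) :
    ∃ (Ω : Type) (_ : MeasurableSpace Ω) (P : Measure Ω) (_ : IsProbabilityMeasure P)
      (θ w : ℕ → Ω → ℝ), IsEnvironment P e θ w ∧ ∫ ω, w 0 ω ∂P = 0 ∧ variance (w 0) P = 1 := by
  have hc : IsProbabilityMeasure (channelLaw e) := by
    constructor
    simp only [channelLaw, Measure.add_apply, Measure.smul_apply, measure_univ, smul_eq_mul,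
      mul_one]
    rw [← ENNReal.ofReal_add he0 (by linarith)]
    simp
  let μ : ℕ ⊕ ℕ → Measure ℝ := Sum.elim (fun _ => channelLaw e) (fun _ => gaussianReal 0 1)
  have hμ : ∀ i, IsProbabilityMeasure (μ i) := by
    rintro (i | i)
    · exact hc
    · exact inferInstanceAs (IsProbabilityMeasure (gaussianReal 0 1))
  let Q := Measure.infinitePi μ
  have hind : iIndepFun (fun (i : ℕ ⊕ ℕ) (ω : ℕ ⊕ ℕ → ℝ) => ω i) Q :=
    iIndepFun_infinitePi (X := fun _ x => x) fun _ => measurable_id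
  have hl : ∀ i, Q.map (fun ω => ω i) = μ i := fun i => Measure.infinitePi_map_eval μ i
  have hid : ∀ k, IdentDistrib (fun ω : ℕ ⊕ ℕ → ℝ => ω (Sum.inr k)) id Q (gaussianReal 0 1) := by
    intro k
    refine ⟨(measurable_pi_apply _).aemeasurable, aemeasurable_id, ?_⟩
    rw [hl, Measure.map_id]
    rfl
  refine ⟨ℕ ⊕ ℕ → ℝ, inferInstance, Q, inferInstance, fun k ω => ω (Sum.inl k),
    fun k ω => ω (Sum.inr k), ⟨fun k => measurable_pi_apply _, hind.precomp Sum.inl_injective,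
      fun k => ?_, fun k => ?_, fun k => measurable_pi_apply _, hind.precomp Sum.inr_injective,
      fun k => (hid k).trans (hid 0).symm, fun k => ?_, ?_⟩, ?_, ?_⟩
  · have := congrArg (fun ν => ν {0}) (hl (Sum.inl k))
    rw [Measure.map_apply (measurable_pi_apply _) (measurableSet_singleton _)] at this
    change Q ((fun ω : ℕ ⊕ ℕ → ℝ => ω (Sum.inl k)) ⁻¹' {0}) = _
    rw [this]
    simp [μ, channelLaw]
  · have := congrArg (fun ν => ν {1}) (hl (Sum.inl k))
    rw [Measure.map_apply (measurable_pi_apply _) (measurableSet_singleton _)] at this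
    change Q ((fun ω : ℕ ⊕ ℕ → ℝ => ω (Sum.inl k)) ⁻¹' {1}) = _
    rw [this]
    simp [μ, channelLaw]
  · exact (hid k).symm.memLp_snd (memLp_id_gaussianReal 2)
  · have hi := indep_iSup_of_disjoint (fun i => (measurable_pi_apply i).comap_le)
      ((iIndepFun_iff_iIndep _ _ _).1 hind) (S := Set.range Sum.inr) (T := Set.range Sum.inl)
      Set.isCompl_range_inl_range_inr.disjoint.symm
    rw [IndepFun_iff_Indep]
    refine indep_of_indep_of_le hi ?_ ?_
    · refine Measurable.comap_le ?_
      refine @measurable_pi_iff _ _ _ (_) _ _ |>.2 fun k => ?_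
      exact Measurable.mono (comap_measurable _)
        (le_iSup₂_of_le (Sum.inr k) (Set.mem_range_self k) le_rfl) le_rfl
    · refine Measurable.comap_le ?_
      refine @measurable_pi_iff _ _ _ (_) _ _ |>.2 fun k => ?_
      exact Measurable.mono (comap_measurable _)
        (le_iSup₂_of_le (Sum.inl k) (Set.mem_range_self k) le_rfl) le_rfl
  · rw [(hid 0).integral_eq]
    simp
  · rw [(hid 0).variance_eq]
    simp

end Environment

/-! ### Second moments of linear recursions with orthogonal innovations. -/

section Moments

open Matrix

variable {Ω : Type*} [mΩ : MeasurableSpace Ω] {P : Measure Ω}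
  {e : ℝ} {θ w : ℕ → Ω → ℝ} {ι : Type*} [Fintype ι]

lemma memLp_dotProduct (F : ι → ℝ) {y : Ω → ι → ℝ} (hy : ∀ i, MemLp (fun ω => y ω i) 2 P) :
    MemLp (fun ω => F ⬝ᵥ y ω) 2 P :=
  memLp_finsetSum _ fun i _ => (hy i).const_mul (F i)

lemma integral_linear_combination (a b : ℝ) {f g h : Ω → ℝ} (hf : Integrable f P)
    (hg : Integrable g P) (hh : Integrable h P) :
    ∫ ω, (a * f ω + b * g ω + h ω) ∂P = a * ∫ ω, f ω ∂P + b * ∫ ω, g ω ∂P + ∫ ω, h ω ∂P := by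
  have h1 : Integrable (fun ω => a * f ω + b * g ω) P := (hf.const_mul a).add (hg.const_mul b)
  rw [integral_add h1 hh, integral_add (hf.const_mul a) (hg.const_mul b), integral_const_mul,
    integral_const_mul]

lemma integral_linear_recursion [IsProbabilityMeasure P] [DecidableEq ι] {N : Matrix ι ι ℝ} {G : ι → ℝ}
    {y : ℕ → Ω → ι → ℝ} {ν : ℕ → Ω → ℝ}
    (hrec : ∀ k ω, y (k + 1) ω = N *ᵥ y k ω + ν k ω • G)
    (hy : ∀ k i, MemLp (fun ω => y k ω i) 2 P) (hν : ∀ k, MemLp (ν k) 2 P)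
    (h0 : ∀ ω, y 0 ω = 0) (hν0 : ∀ k, ∫ ω, ν k ω ∂P = 0) (k : ℕ) (F : ι → ℝ) :
    ∫ ω, F ⬝ᵥ y k ω ∂P = 0 := by
  induction k generalizing F with
  | zero => simp [h0]
  | succ k ih =>
    have h1 : ∀ ω, F ⬝ᵥ y (k + 1) ω = (F ᵥ* N) ⬝ᵥ y k ω + ν k ω * (F ⬝ᵥ G) := by
      intro ω
      rw [hrec, dotProduct_add, dotProduct_mulVec, dotProduct_smul, smul_eq_mul]
    simp only [h1]
    rw [integral_add ((memLp_dotProduct _ (hy k)).integrable one_le_two)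
      (((hν k).integrable one_le_two).mul_const _), ih, integral_mul_const, hν0]
    ring

/-- Second moments of a linear recursion driven by innovations orthogonal to the state. -/
lemma integral_sq_linear_recursion [DecidableEq ι] {N : Matrix ι ι ℝ} {G : ι → ℝ}
    {y : ℕ → Ω → ι → ℝ} {ν : ℕ → Ω → ℝ}
    (hrec : ∀ k ω, y (k + 1) ω = N *ᵥ y k ω + ν k ω • G)
    (hy : ∀ k i, MemLp (fun ω => y k ω i) 2 P) (hν : ∀ k, MemLp (ν k) 2 P)
    (horth : ∀ k i, ∫ ω, ν k ω * y k ω i ∂P = 0) (k : ℕ) (F : ι → ℝ) :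
    ∫ ω, (F ⬝ᵥ y k ω) ^ 2 ∂P = ∫ ω, (F ⬝ᵥ ((N ^ k) *ᵥ y 0 ω)) ^ 2 ∂P +
      ∑ j ∈ Finset.range k, (F ⬝ᵥ ((N ^ (k - 1 - j)) *ᵥ G)) ^ 2 * ∫ ω, ν j ω ^ 2 ∂P := by
  induction k generalizing F with
  | zero => simp
  | succ k ih =>
    -- One step of the recursion moves N into the functional, which is why the induction runs over
    -- all F.
    set F' := F ᵥ* N with hF'
    have h1 : ∀ ω, (F ⬝ᵥ y (k + 1) ω) ^ 2 = (F ⬝ᵥ G) ^ 2 * ν k ω ^ 2 +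
        2 * (F ⬝ᵥ G) * (ν k ω * (F' ⬝ᵥ y k ω)) + (F' ⬝ᵥ y k ω) ^ 2 := by
      intro ω
      rw [hrec, dotProduct_add, dotProduct_mulVec, dotProduct_smul, smul_eq_mul]
      ring
    have hL : MemLp (fun ω => F' ⬝ᵥ y k ω) 2 P := memLp_dotProduct _ (hy k)
    have hcross : Integrable (fun ω => ν k ω * (F' ⬝ᵥ y k ω)) P := (hν k).integrable_mul hL
    have hc0 : ∫ ω, ν k ω * (F' ⬝ᵥ y k ω) ∂P = 0 := by
      have : ∀ ω, ν k ω * (F' ⬝ᵥ y k ω) = ∑ i, F' i * (ν k ω * y k ω i) := by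
        intro ω
        rw [dotProduct, Finset.mul_sum]
        exact Finset.sum_congr rfl fun i _ => by ring
      simp only [this]
      have hint : ∀ i, Integrable (fun ω => F' i * (ν k ω * y k ω i)) P :=
        fun i => ((hν k).integrable_mul (hy k i)).const_mul _
      rw [integral_finsetSum _ fun i _ => hint i]
      simp only [integral_const_mul, horth, mul_zero, Finset.sum_const_zero]
    simp only [h1]
    rw [integral_linear_combination _ _ (hν k).integrable_sq hcross hL.integrable_sq, hc0, ih,
      Finset.sum_range_succ]
    have h2 : ∀ (m : ℕ) (v : ι → ℝ), F ⬝ᵥ ((N ^ (m + 1)) *ᵥ v) = F' ⬝ᵥ ((N ^ m) *ᵥ v) := by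
      intro m v
      rw [pow_succ', ← mulVec_mulVec, dotProduct_mulVec]
    have h3 : ∀ j ∈ Finset.range k, (F ⬝ᵥ ((N ^ (k + 1 - 1 - j)) *ᵥ G)) ^ 2 * ∫ ω, ν j ω ^ 2 ∂P =
        (F' ⬝ᵥ ((N ^ (k - 1 - j)) *ᵥ G)) ^ 2 * ∫ ω, ν j ω ^ 2 ∂P := by
      intro j hj
      have := Finset.mem_range.1 hj
      rw [show k + 1 - 1 - j = (k - 1 - j) + 1 by omega, h2]
    rw [Finset.sum_congr rfl h3]
    simp only [h2, Nat.add_sub_cancel, Nat.sub_self, pow_zero, one_mulVec]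
    ring

/-- The innovation `κ (w(k) - E w) + (θ(k) - (1 - e)) b`. -/
def innovation (P : Measure Ω) (e : ℝ) (θ w : ℕ → Ω → ℝ) (κ : ℝ) (k : ℕ) (b : Ω → ℝ) (ω : Ω) : ℝ :=
  κ * (w k ω - ∫ ω, w 0 ω ∂P) + (θ k ω - (1 - e)) * b ω

section Innovation

variable [IsProbabilityMeasure P] (h : IsEnvironment P e θ w) (he0 : 0 ≤ e) (he1 : e ≤ 1)
include h he0 he1

lemma IsEnvironment.memLp_channel_mul (k : ℕ) {b : Ω → ℝ} (hb : MemLp b 2 P) :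
    MemLp (fun ω => (θ k ω - (1 - e)) * b ω) 2 P := by
  refine hb.of_le ((((h.measurable_channel k).sub_const _).aestronglyMeasurable).mul
    hb.aestronglyMeasurable) ?_
  filter_upwards [h.channel_ae he0 he1 k] with ω hω
  rw [norm_mul]
  refine mul_le_of_le_one_left (norm_nonneg _) ?_
  rw [Real.norm_eq_abs, abs_le]
  rcases hω with hω | hω <;> rw [hω] <;> constructor <;> linarith

lemma IsEnvironment.memLp_innovation (κ : ℝ) (k : ℕ) {b : Ω → ℝ} (hb : MemLp b 2 P) :
    MemLp (innovation P e θ w κ k b) 2 P :=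
  (((h.memLp_input k).sub (memLp_const _)).const_mul κ).add (h.memLp_channel_mul he0 he1 k hb)

lemma IsEnvironment.integral_channel_sub_mul {S : Set ℕ} {k : ℕ} (hk : k ∉ S) {f : Ω → ℝ}
    (hf : Measurable[noiseAlg θ w S] f) :
    ∫ ω, (θ k ω - (1 - e)) * f ω ∂P = 0 := by
  have hd : Disjoint {k} S := Set.disjoint_singleton_left.2 hk
  rw [h.integral_mul hd
    ((measurable_channel_noiseAlg (w := w) (Set.mem_singleton k)).sub_const (1 - e)) hf,
    h.integral_channel he0 he1 k fun x => x - (1 - e)]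
  ring

lemma IsEnvironment.integral_channel_sub_sq_mul {S : Set ℕ} {k : ℕ} (hk : k ∉ S) {f : Ω → ℝ}
    (hf : Measurable[noiseAlg θ w S] f) :
    ∫ ω, (θ k ω - (1 - e)) ^ 2 * f ω ∂P = e * (1 - e) * ∫ ω, f ω ∂P := by
  have hd : Disjoint {k} S := Set.disjoint_singleton_left.2 hk
  rw [h.integral_mul hd
    (((measurable_channel_noiseAlg (w := w) (Set.mem_singleton k)).sub_const (1 - e)).pow_const 2)
    hf, h.integral_channel he0 he1 k fun x => (x - (1 - e)) ^ 2]
  ring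

lemma IsEnvironment.integral_channel_sq_mul {S : Set ℕ} {k : ℕ} (hk : k ∉ S) {f : Ω → ℝ}
    (hf : Measurable[noiseAlg θ w S] f) :
    ∫ ω, θ k ω ^ 2 * f ω ∂P = (1 - e) * ∫ ω, f ω ∂P := by
  have hd : Disjoint {k} S := Set.disjoint_singleton_left.2 hk
  rw [h.integral_mul hd
    ((measurable_channel_noiseAlg (w := w) (Set.mem_singleton k)).pow_const 2) hf,
    h.integral_channel he0 he1 k fun x => x ^ 2]
  ring

omit he0 he1 in
lemma IsEnvironment.integral_input_sub_mul {S : Set ℕ} {k : ℕ} (hk : k ∉ S) {f : Ω → ℝ}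
    (hf : Measurable[noiseAlg θ w S] f) :
    ∫ ω, (w k ω - ∫ ω, w 0 ω ∂P) * f ω ∂P = 0 := by
  have hd : Disjoint {k} S := Set.disjoint_singleton_left.2 hk
  rw [h.integral_mul hd
    ((measurable_input_noiseAlg (θ := θ) (Set.mem_singleton k)).sub_const _) hf,
    integral_sub ((h.memLp_input k).integrable one_le_two) (integrable_const _),
    (h.ident_input k).integral_eq]
  simp

/-- Both b and f depend on the noise at times other than k only, whereas the factors from time k are
centred. -/
lemma IsEnvironment.integral_innovation_mul (κ : ℝ) {S : Set ℕ} {k : ℕ} (hk : k ∉ S)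
    {b f : Ω → ℝ} (hbm : Measurable[noiseAlg θ w S] b) (hb : MemLp b 2 P)
    (hfm : Measurable[noiseAlg θ w S] f) (hf : MemLp f 2 P) :
    ∫ ω, innovation P e θ w κ k b ω * f ω ∂P = 0 := by
  have h1 : ∀ ω, innovation P e θ w κ k b ω * f ω =
      κ * ((w k ω - ∫ ω, w 0 ω ∂P) * f ω) + 1 * ((θ k ω - (1 - e)) * (b ω * f ω)) + 0 := by
    intro ω; unfold innovation; ring
  have hw : MemLp (fun ω => w k ω - ∫ ω, w 0 ω ∂P) 2 P := (h.memLp_input k).sub (memLp_const _)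
  have hi1 : Integrable (fun ω => (w k ω - ∫ ω, w 0 ω ∂P) * f ω) P := hw.integrable_mul hf
  have hi2 : Integrable (fun ω => (θ k ω - (1 - e)) * (b ω * f ω)) P := by
    have : Integrable (fun ω => (θ k ω - (1 - e)) * b ω * f ω) P :=
      (h.memLp_channel_mul he0 he1 k hb).integrable_mul hf
    simpa only [mul_assoc] using this
  simp only [h1]
  rw [integral_linear_combination _ _ hi1 hi2 (integrable_const 0),
    h.integral_input_sub_mul hk hfm, h.integral_channel_sub_mul he0 he1 hk (f := fun ω => b ω * f ω) (hbm.mul hfm)]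
  simp

/-- A channel gain has variance e(1-e). The cross term vanishes because w(k), θ(k) and b can be
separated: first b from the pair at time k, then w(k) from θ(k). -/
lemma IsEnvironment.integral_innovation_sq (κ : ℝ) {S : Set ℕ} {k : ℕ} (hk : k ∉ S)
    {b : Ω → ℝ} (hbm : Measurable[noiseAlg θ w S] b) (hb : MemLp b 2 P) :
    ∫ ω, innovation P e θ w κ k b ω ^ 2 ∂P =
      κ ^ 2 * variance (w 0) P + e * (1 - e) * ∫ ω, b ω ^ 2 ∂P := by
  set m := ∫ ω, w 0 ω ∂P with hm
  have h1 : ∀ ω, innovation P e θ w κ k b ω ^ 2 =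
      κ ^ 2 * (w k ω - m) ^ 2 + 2 * κ * ((w k ω - m) * ((θ k ω - (1 - e)) * b ω)) +
        (θ k ω - (1 - e)) ^ 2 * b ω ^ 2 := by
    intro ω; unfold innovation; ring
  have hw : MemLp (fun ω => w k ω - m) 2 P := (h.memLp_input k).sub (memLp_const _)
  have ht := h.memLp_channel_mul he0 he1 k hb
  have hi : Integrable (fun ω => (θ k ω - (1 - e)) ^ 2 * b ω ^ 2) P := by
    simpa only [mul_pow] using ht.integrable_sq
  have hvar : ∫ ω, (w k ω - m) ^ 2 ∂P = variance (w 0) P := by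
    rw [← (h.ident_input k).variance_eq, variance_eq_integral (h.measurable_input k).aemeasurable,
      (h.ident_input k).integral_eq]
  have hcross : ∫ ω, (w k ω - m) * ((θ k ω - (1 - e)) * b ω) ∂P = 0 := by
    have hX : IndepFun (fun ω => (w k ω - m) * (θ k ω - (1 - e))) b P := by
      refine h.indepFun_of_disjoint (Set.disjoint_singleton_left.2 hk) ?_ hbm
      exact ((measurable_input_noiseAlg (θ := θ) (Set.mem_singleton k)).sub_const _).mul
        ((measurable_channel_noiseAlg (w := w) (Set.mem_singleton k)).sub_const _)
    have hwt : IndepFun (w k) (θ k) P :=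
      h.indep_input_channel.comp (measurable_pi_apply k) (measurable_pi_apply k)
    have hwt' : IndepFun (fun ω => w k ω - m) (fun ω => θ k ω - (1 - e)) P :=
      hwt.comp (measurable_id.sub_const m) (measurable_id.sub_const (1 - e))
    have hθ0 : ∫ ω, (θ k ω - (1 - e)) ∂P = 0 := by
      rw [h.integral_channel he0 he1 k fun x => x - (1 - e)]
      ring
    simp only [← mul_assoc]
    rw [hX.integral_fun_mul_eq_mul_integral
      (((h.measurable_input k).sub_const _).mul
        ((h.measurable_channel k).sub_const _)).aestronglyMeasurable hb.aestronglyMeasurable,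
      hwt'.integral_fun_mul_eq_mul_integral
        ((h.measurable_input k).sub_const _).aestronglyMeasurable
        ((h.measurable_channel k).sub_const _).aestronglyMeasurable, hθ0]
    ring
  simp only [h1]
  have hi2 : Integrable (fun ω => (w k ω - m) * ((θ k ω - (1 - e)) * b ω)) P :=
    hw.integrable_mul ht
  rw [integral_linear_combination _ _ hw.integrable_sq hi2 hi, hvar, hcross,
    h.integral_channel_sub_sq_mul he0 he1 hk (hbm.pow_const 2)]
  ring

end Innovation

end Moments

/-! ### The loop as a linear recursion, and its restarted copies. -/

section LoopMoments

open Matrix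

variable {n : ℕ} (A : Matrix (Fin n) (Fin n) ℝ) (B : Fin n → ℝ) (K : Controller n)

/-- The joint loop state as a single vector. -/
def loopVec (θ w : ℕ → ℝ) (k : ℕ) : Fin n ⊕ Fin K.order → ℝ :=
  Sum.elim (loopState A B K θ w k).1 (loopState A B K θ w k).2

lemma ctrl_eq_dotProduct (θ w : ℕ → ℝ) (k : ℕ) :
    ctrl A B K θ w k = loopOutput K ⬝ᵥ loopVec A B K θ w k := by
  rw [ctrl, Controller.output, loopOutput, loopVec, sumElim_dotProduct_sumElim, add_comm]

lemma loopVec_zero (θ w : ℕ → ℝ) : loopVec A B K θ w 0 = 0 := by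
  ext i
  rcases i with i | i <;> rfl

/-- The channel gain is split into 1 - e, absorbed by the nominal matrix, and a fluctuation that
acts like an additional input. As an identity it holds for any e. -/
lemma loopVec_succ (e : ℝ) (θ w : ℕ → ℝ) (k : ℕ) :
    loopVec A B K θ w (k + 1) = nominalMatrix A B K e *ᵥ loopVec A B K θ w k +
      (w k + (θ k - (1 - e)) * (loopOutput K ⬝ᵥ loopVec A B K θ w k)) • loopInput B K := by
  rw [← ctrl_eq_dotProduct]
  set s := loopState A B K θ w k with hs
  have h1 : loopVec A B K θ w (k + 1) = Sum.elim (A.mulVec s.1 + (w k + θ k * K.output s) • B)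
    (K.Ac.mulVec s.2 + K.Bc.mulVec s.1) := rfl
  have h2 : loopVec A B K θ w k = Sum.elim s.1 s.2 := rfl
  have h3 : ctrl A B K θ w k = K.output s := rfl
  rw [h1, h2, h3, nominalMatrix, fromBlocks_mulVec]
  ext i
  rcases i with i | i
  · simp [loopInput, add_mulVec, smul_mulVec, vecMulVec_mulVec, Controller.output]
    ring
  · simp [loopInput, add_comm]

lemma measurable_loopVec {Ω : Type*} {m : MeasurableSpace Ω} {θ w : ℕ → Ω → ℝ} {k : ℕ}
    (hθ : ∀ j < k, Measurable (θ j)) (hw : ∀ j < k, Measurable (w j)) :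
    Measurable fun ω => loopVec A B K (fun j => θ j ω) (fun j => w j ω) k := by
  induction k with
  | zero => simp only [loopVec_zero]; exact measurable_const
  | succ k ih =>
    have ih' := ih (fun j hj => hθ j (by omega)) (fun j hj => hw j (by omega))
    have hk := hθ k (by omega)
    have hk' := hw k (by omega)
    simp only [loopVec_succ A B K 0]
    have hc1 : Continuous fun v : Fin n ⊕ Fin K.order → ℝ => nominalMatrix A B K 0 *ᵥ v :=
      continuous_const.matrix_mulVec continuous_id
    have hc2 : Continuous fun v : Fin n ⊕ Fin K.order → ℝ => loopOutput K ⬝ᵥ v :=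
      continuous_const.dotProduct continuous_id
    exact (hc1.measurable.comp ih').add
      ((hk'.add ((hk.sub_const _).mul (hc2.measurable.comp ih'))).smul_const _)

/-- The loop state at time `k + i` of the loop that is started at rest at time `i`. -/
def restartVec {Ω : Type*} (θ w : ℕ → Ω → ℝ) (i k : ℕ) (ω : Ω) : Fin n ⊕ Fin K.order → ℝ :=
  loopVec A B K (fun j => θ (j + i) ω) (fun j => w (j + i) ω) k

variable {Ω : Type*} {θ w : ℕ → Ω → ℝ}

lemma measurable_restartVec (i k : ℕ) :
    Measurable[noiseAlg θ w (Set.Ico i (k + i))] (restartVec A B K θ w i k) := by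
  refine @measurable_loopVec _ A B K Ω (noiseAlg θ w (Set.Ico i (k + i))) (fun j => θ (j + i))
    (fun j => w (j + i)) k (fun j hj => ?_) (fun j hj => ?_)
  · exact measurable_channel_noiseAlg ⟨by omega, by omega⟩
  · exact measurable_input_noiseAlg ⟨by omega, by omega⟩

lemma measurable_dotProduct_noiseAlg {κ : Type*} [Fintype κ] {S : Set ℕ} (F : κ → ℝ)
    {y : Ω → κ → ℝ} (hy : Measurable[noiseAlg θ w S] y) :
    Measurable[noiseAlg θ w S] fun ω => F ⬝ᵥ y ω := by
  have hc : Continuous fun v : κ → ℝ => F ⬝ᵥ v := continuous_const.dotProduct continuous_id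
  exact hc.measurable.comp hy

variable [mΩ : MeasurableSpace Ω] {P : Measure Ω} [IsProbabilityMeasure P] {e : ℝ}
  (h : IsEnvironment P e θ w) (he0 : 0 ≤ e) (he1 : e ≤ 1)
include h he0 he1

lemma IsEnvironment.memLp_restartVec (i k : ℕ) (a : Fin n ⊕ Fin K.order) :
    MemLp (fun ω => restartVec A B K θ w i k ω a) 2 P := by
  induction k generalizing a with
  | zero =>
    have : (fun ω => restartVec A B K θ w i 0 ω a) = fun _ => (0 : ℝ) := by
      funext ω; rw [restartVec, loopVec_zero]; rfl
    rw [this]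
    exact memLp_const 0
  | succ k ih =>
    have h1 : (fun ω => restartVec A B K θ w i (k + 1) ω a) = fun ω =>
        (fun b => nominalMatrix A B K e a b) ⬝ᵥ restartVec A B K θ w i k ω +
        (w (k + i) ω + (θ (k + i) ω - (1 - e)) * (loopOutput K ⬝ᵥ restartVec A B K θ w i k ω)) *
          loopInput B K a := by
      funext ω
      rw [restartVec, loopVec_succ A B K e]
      rfl
    rw [h1]
    exact (memLp_dotProduct _ ih).add (((h.memLp_input _).add
      (h.memLp_channel_mul he0 he1 _ (memLp_dotProduct _ ih))).mul_const _)

/-- The deterministic response to the mean of the input. -/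
def meanVec (e μ : ℝ) (k : ℕ) : Fin n ⊕ Fin K.order → ℝ :=
  ∑ j ∈ Finset.range k, (nominalMatrix A B K e ^ j) *ᵥ (μ • loopInput B K)

omit h he0 he1 in
lemma meanVec_succ (e μ : ℝ) (k : ℕ) :
    meanVec A B K e μ (k + 1) =
      nominalMatrix A B K e *ᵥ meanVec A B K e μ k + μ • loopInput B K := by
  rw [meanVec, Finset.sum_range_succ', meanVec, mulVec_sum]
  simp only [pow_succ', ← mulVec_mulVec, pow_zero, one_mulVec]

/-- Subtracting the response to the mean input leaves a recursion driven by innovations orthogonal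
to the past. Their variances involve the uncentred output, since the channel multiplies the whole of
u. -/
lemma IsEnvironment.centered_moments (k : ℕ) (F : Fin n ⊕ Fin K.order → ℝ) :
    ∫ ω, F ⬝ᵥ (restartVec A B K θ w 0 k ω - meanVec A B K e (∫ ω, w 0 ω ∂P) k) ∂P = 0 ∧
    ∫ ω, (F ⬝ᵥ (restartVec A B K θ w 0 k ω - meanVec A B K e (∫ ω, w 0 ω ∂P) k)) ^ 2 ∂P =
      ∑ j ∈ Finset.range k,
        (F ⬝ᵥ ((nominalMatrix A B K e ^ (k - 1 - j)) *ᵥ loopInput B K)) ^ 2 *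
        (variance (w 0) P +
          e * (1 - e) * ∫ ω, (loopOutput K ⬝ᵥ restartVec A B K θ w 0 j ω) ^ 2 ∂P) := by
  set μ := ∫ ω, w 0 ω ∂P with hμ
  set y : ℕ → Ω → Fin n ⊕ Fin K.order → ℝ :=
    fun k ω => restartVec A B K θ w 0 k ω - meanVec A B K e μ k with hy
  set ν : ℕ → Ω → ℝ := fun k =>
    innovation P e θ w 1 k (fun ω => loopOutput K ⬝ᵥ restartVec A B K θ w 0 k ω) with hν
  have hz : ∀ k, MemLp (fun ω => loopOutput K ⬝ᵥ restartVec A B K θ w 0 k ω) 2 P := fun k =>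
    memLp_dotProduct _ (h.memLp_restartVec A B K he0 he1 0 k)
  have hzm : ∀ k, Measurable[noiseAlg θ w (Set.Ico 0 (k + 0))]
      fun ω => loopOutput K ⬝ᵥ restartVec A B K θ w 0 k ω := fun k =>
    measurable_dotProduct_noiseAlg _ (measurable_restartVec A B K 0 k)
  have hk : ∀ k, k ∉ Set.Ico 0 (k + 0) := fun k hk => lt_irrefl _ hk.2
  have hrec : ∀ k ω, y (k + 1) ω = nominalMatrix A B K e *ᵥ y k ω + ν k ω • loopInput B K := by
    intro k ω
    simp only [hy, hν, innovation]
    rw [restartVec, loopVec_succ A B K e, meanVec_succ, mulVec_sub]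
    change _ + (w k ω + (θ k ω - (1 - e)) * (loopOutput K ⬝ᵥ restartVec A B K θ w 0 k ω)) • _ - _ =
      nominalMatrix A B K e *ᵥ restartVec A B K θ w 0 k ω - _ + _
    change nominalMatrix A B K e *ᵥ restartVec A B K θ w 0 k ω + _ - _ = _
    rw [← hμ, one_mul]
    module
  have hyL : ∀ k a, MemLp (fun ω => y k ω a) 2 P := fun k a =>
    (h.memLp_restartVec A B K he0 he1 0 k a).sub (memLp_const _)
  have hym : ∀ k a, Measurable[noiseAlg θ w (Set.Ico 0 (k + 0))] fun ω => y k ω a := by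
    intro k a
    exact ((measurable_pi_apply a).comp (measurable_restartVec A B K 0 k)).sub_const _
  have hνL : ∀ k, MemLp (ν k) 2 P := fun k => h.memLp_innovation he0 he1 1 k (hz k)
  have hy0 : ∀ ω, y 0 ω = 0 := by
    intro ω
    simp only [hy, restartVec, loopVec_zero, meanVec, Finset.range_zero, Finset.sum_empty, sub_zero]
  refine ⟨integral_linear_recursion hrec hyL hνL hy0 (fun k => ?_) k F, ?_⟩
  · have := h.integral_innovation_mul he0 he1 1 (hk k) (hzm k) (hz k)
      (f := fun _ => 1) measurable_const (memLp_const 1)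
    simpa only [mul_one] using this
  · have := integral_sq_linear_recursion hrec hyL hνL (fun k a =>
      h.integral_innovation_mul he0 he1 1 (hk k) (hzm k) (hz k) (hym k a) (hyL k a)) k F
    rw [this]
    simp only [hy0, mulVec_zero, dotProduct_zero]
    rw [zero_pow two_ne_zero, integral_zero, zero_add]
    refine Finset.sum_congr rfl fun j _ => ?_
    rw [h.integral_innovation_sq he0 he1 1 (hk j) (hzm j) (hz j), one_pow, one_mul]

/-- From time i on both loops see the same noise, so w cancels in the difference (κ = 0). What is
left is a loop without input, started at the true state at time i. -/
lemma IsEnvironment.restart_error (i k : ℕ) :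
    ∫ ω, (loopOutput K ⬝ᵥ (restartVec A B K θ w 0 (k + i) ω - restartVec A B K θ w i k ω)) ^ 2 ∂P =
      ∫ ω, (loopOutput K ⬝ᵥ ((nominalMatrix A B K e ^ k) *ᵥ restartVec A B K θ w 0 i ω)) ^ 2 ∂P +
      ∑ j ∈ Finset.range k, impulse A B e K (k - 1 - j) ^ 2 * (e * (1 - e) *
        ∫ ω, (loopOutput K ⬝ᵥ
          (restartVec A B K θ w 0 (j + i) ω - restartVec A B K θ w i j ω)) ^ 2 ∂P) := by
  set y : ℕ → Ω → Fin n ⊕ Fin K.order → ℝ :=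
    fun k ω => restartVec A B K θ w 0 (k + i) ω - restartVec A B K θ w i k ω with hy
  set ν : ℕ → Ω → ℝ := fun k =>
    innovation P e θ w 0 (k + i) (fun ω => loopOutput K ⬝ᵥ y k ω) with hν
  have hyL : ∀ k a, MemLp (fun ω => y k ω a) 2 P := fun k a =>
    (h.memLp_restartVec A B K he0 he1 0 (k + i) a).sub (h.memLp_restartVec A B K he0 he1 i k a)
  have hym : ∀ k, Measurable[noiseAlg θ w (Set.Ico 0 (k + i))] (y k) := by
    intro k
    refine Measurable.sub (measurable_restartVec A B K 0 (k + i)) ?_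
    exact (measurable_restartVec A B K i k).mono
      (noiseAlg_mono (Set.Ico_subset_Ico_left (Nat.zero_le i))) le_rfl
  have hk : ∀ k, k + i ∉ Set.Ico 0 (k + i) := fun k hk => lt_irrefl _ hk.2
  have hz : ∀ k, MemLp (fun ω => loopOutput K ⬝ᵥ y k ω) 2 P := fun k => memLp_dotProduct _ (hyL k)
  have hzm : ∀ k, Measurable[noiseAlg θ w (Set.Ico 0 (k + i))]
      fun ω => loopOutput K ⬝ᵥ y k ω := fun k => measurable_dotProduct_noiseAlg _ (hym k)
  have hrec : ∀ k ω, y (k + 1) ω = nominalMatrix A B K e *ᵥ y k ω + ν k ω • loopInput B K := by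
    intro k ω
    simp only [hy, hν, innovation]
    rw [show k + 1 + i = (k + i) + 1 by ring, restartVec, loopVec_succ A B K e, restartVec,
      loopVec_succ A B K e, mulVec_sub, dotProduct_sub]
    change (_ *ᵥ restartVec A B K θ w 0 (k + i) ω + (w (k + i) ω + (θ (k + i) ω - (1 - e)) *
      (loopOutput K ⬝ᵥ restartVec A B K θ w 0 (k + i) ω)) • _) -
      (_ *ᵥ restartVec A B K θ w i k ω + (w (k + i) ω + (θ (k + i) ω - (1 - e)) *
      (loopOutput K ⬝ᵥ restartVec A B K θ w i k ω)) • _) = _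
    module
  have hνL : ∀ k, MemLp (ν k) 2 P := fun k => h.memLp_innovation he0 he1 0 (k + i) (hz k)
  have := integral_sq_linear_recursion hrec hyL hνL (fun k a =>
      h.integral_innovation_mul he0 he1 0 (hk k) (hzm k) (hz k)
        ((measurable_pi_apply a).comp (hym k)) (hyL k a)) k (loopOutput K)
  rw [this]
  congr 1
  · have h0 : ∀ ω, y 0 ω = restartVec A B K θ w 0 i ω := by
      intro ω
      simp only [hy, zero_add]
      rw [restartVec, restartVec, loopVec_zero, sub_zero]
    simp only [h0]
  · refine Finset.sum_congr rfl fun j _ => ?_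
    rw [h.integral_innovation_sq he0 he1 0 (hk j) (hzm j) (hz j), impulse]
    ring

end LoopMoments

/-! ### Mean-square stability as a bound on the gain. -/

section Stability

open Matrix

variable {n : ℕ} {A : Matrix (Fin n) (Fin n) ℝ} {B : Fin n → ℝ} {e : ℝ} {K : Controller n}

lemma dotProduct_meanVec (F : Fin n ⊕ Fin K.order → ℝ) (μ : ℝ) (k : ℕ) :
    F ⬝ᵥ meanVec A B K e μ k =
      μ * ∑ j ∈ Finset.range k, F ⬝ᵥ ((nominalMatrix A B K e ^ j) *ᵥ loopInput B K) := by
  rw [meanVec, dotProduct_sum, Finset.mul_sum]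
  refine Finset.sum_congr rfl fun j _ => ?_
  rw [mulVec_smul, dotProduct_smul, smul_eq_mul]

lemma gain_nonneg : 0 ≤ gain A B e K := tsum_nonneg fun _ => sq_nonneg _

lemma notMem_Ico_add (i k : ℕ) : k + i ∉ Set.Ico i (k + i) := fun hk => lt_irrefl _ hk.2

lemma measurable_output {Ω : Type*} {θ w : ℕ → Ω → ℝ} (i k : ℕ) :
    Measurable[noiseAlg θ w (Set.Ico i (k + i))]
      fun ω => loopOutput K ⬝ᵥ restartVec A B K θ w i k ω :=
  measurable_dotProduct_noiseAlg _ (measurable_restartVec A B K i k)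

variable {Ω : Type*} [mΩ : MeasurableSpace Ω] {P : Measure Ω} [IsProbabilityMeasure P]
  {θ w : ℕ → Ω → ℝ}

omit mΩ in
lemma ctrl_eq_restartVec (k : ℕ) (ω : Ω) :
    ctrl A B K (fun j => θ j ω) (fun j => w j ω) k =
      loopOutput K ⬝ᵥ restartVec A B K θ w 0 k ω :=
  ctrl_eq_dotProduct A B K _ _ k

omit mΩ in
lemma residual_eq (k : ℕ) (ω : Ω) :
    residual A B K e (fun j => θ j ω) (fun j => w j ω) k =
      (θ k ω - (1 - e)) * (loopOutput K ⬝ᵥ restartVec A B K θ w 0 k ω) := by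
  rw [residual, corruptedCtrl, ctrl_eq_restartVec]
  ring

/-- The second moment of the controller output. -/
def outputMoment (A : Matrix (Fin n) (Fin n) ℝ) (B : Fin n → ℝ) (K : Controller n)
    (P : Measure Ω) (θ w : ℕ → Ω → ℝ) (k : ℕ) : ℝ :=
  ∫ ω, (loopOutput K ⬝ᵥ restartVec A B K θ w 0 k ω) ^ 2 ∂P

variable (h : IsEnvironment P e θ w) (he0 : 0 ≤ e) (he1 : e ≤ 1)
include h he0 he1

lemma IsEnvironment.memLp_output (k : ℕ) :
    MemLp (fun ω => loopOutput K ⬝ᵥ restartVec A B K θ w 0 k ω) 2 P :=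
  memLp_dotProduct _ (h.memLp_restartVec A B K he0 he1 0 k)

lemma IsEnvironment.integral_sq_standard (h0 : ∫ ω, w 0 ω ∂P = 0) (h1 : variance (w 0) P = 1)
    (k : ℕ) (F : Fin n ⊕ Fin K.order → ℝ) :
    ∫ ω, (F ⬝ᵥ restartVec A B K θ w 0 k ω) ^ 2 ∂P =
      ∑ j ∈ Finset.range k,
        (F ⬝ᵥ ((nominalMatrix A B K e ^ (k - 1 - j)) *ᵥ loopInput B K)) ^ 2 *
        (1 + e * (1 - e) * outputMoment A B K P θ w j) := by
  have hm : meanVec A B K e 0 k = 0 := by simp [meanVec]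
  have := (h.centered_moments A B K he0 he1 k F).2
  rw [h0, hm, h1] at this
  simpa only [sub_zero, outputMoment] using this

lemma IsEnvironment.outputMoment_renewal (h0 : ∫ ω, w 0 ω ∂P = 0) (h1 : variance (w 0) P = 1)
    (k : ℕ) :
    outputMoment A B K P θ w k = ∑ j ∈ Finset.range k, impulse A B e K (k - 1 - j) ^ 2 *
        (1 + e * (1 - e) * outputMoment A B K P θ w j) :=
  h.integral_sq_standard he0 he1 h0 h1 k (loopOutput K)

/-- θ(k) - (1 - e) is centred and independent of u(k). Hence the full second moment of u appears,
not merely its variance. -/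
lemma IsEnvironment.variance_residual (k : ℕ) :
    variance (fun ω => residual A B K e (fun j => θ j ω) (fun j => w j ω) k) P =
      e * (1 - e) * outputMoment A B K P θ w k := by
  simp only [residual_eq]
  rw [variance_eq_sub (h.memLp_channel_mul he0 he1 k (h.memLp_output he0 he1 k)),
    h.integral_channel_sub_mul he0 he1 (k := k) (notMem_Ico_add 0 k) (measurable_output 0 k)]
  have := h.integral_channel_sub_sq_mul he0 he1 (k := k) (notMem_Ico_add 0 k)
    ((measurable_output (A := A) (B := B) (K := K) 0 k).pow_const 2)
  simp only [Pi.pow_apply, mul_pow]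
  rw [this, outputMoment]
  ring

omit h in
lemma erasure_variance_nonneg : 0 ≤ e * (1 - e) := mul_nonneg he0 (by linarith)

omit h mΩ in
-- One standardized environment suffices: bounded residual variances bound the solution of the
-- renewal equation, unless e(1-e) = 0, when nothing is claimed.
lemma MeanSquareStable.gain_lt (hK : MeanSquareStable A B e K) : e * (1 - e) * gain A B e K < 1 := by
  obtain ⟨Ω, mΩ, P, hP, θ, w, h, h0, h1⟩ := exists_environment he0 he1
  obtain ⟨C, hC⟩ := hK.2 Ω P θ w h
  have hσ := erasure_variance_nonneg he0 he1
  rcases hσ.eq_or_lt with hσ0 | hσ0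
  · rw [← hσ0, zero_mul]; exact one_pos
  · refine (renewal_tendsto (fun t => sq_nonneg (impulse A B e K t)) (hK.1.summable_sq _ _) hσ
      (h.outputMoment_renewal he0 he1 h0 h1) (C := C / (e * (1 - e))) fun k => ?_).1
    rw [le_div_iff₀ hσ0, mul_comm, ← h.variance_residual he0 he1]
    exact (hC k).2

omit h mΩ in
-- The input may have nonzero mean, but the mean response is bounded by |μ| times the ℓ¹ norm of the
-- impulse response. The centred second moment is then a renewal subsolution with constant forcing.
lemma meanSquareStable_of_gain_lt (hN : SchurStable (nominalMatrix A B K e))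
    (hg : e * (1 - e) * gain A B e K < 1) : MeanSquareStable A B e K := by
  refine ⟨hN, fun Ω _ P _ θ w h => ?_⟩
  have hσ := erasure_variance_nonneg he0 he1
  set μ := ∫ ω, w 0 ω ∂P with hμ
  set m := |μ| * ∑' t, |impulse A B e K t| with hm
  have hm0 : 0 ≤ m := mul_nonneg (abs_nonneg _) (tsum_nonneg fun _ => abs_nonneg _)
  have hmean : ∀ k, (loopOutput K ⬝ᵥ meanVec A B K e μ k) ^ 2 ≤ m ^ 2 := by
    intro k
    rw [sq_le_sq, abs_of_nonneg hm0, dotProduct_meanVec, abs_mul]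
    refine mul_le_mul_of_nonneg_left ((Finset.abs_sum_le_sum_abs _ _).trans ?_) (abs_nonneg _)
    exact (hN.summable_abs (loopInput B K) (loopOutput K)).sum_le_tsum _ fun _ _ => abs_nonneg _
  set V : ℕ → ℝ := fun k =>
    ∫ ω, (loopOutput K ⬝ᵥ (restartVec A B K θ w 0 k ω - meanVec A B K e μ k)) ^ 2 ∂P with hV
  have hL : ∀ k, MemLp (fun ω => loopOutput K ⬝ᵥ
      (restartVec A B K θ w 0 k ω - meanVec A B K e μ k)) 2 P := by
    intro k
    simp only [dotProduct_sub]
    exact (h.memLp_output he0 he1 k).sub (memLp_const _)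
  have hU : ∀ k, outputMoment A B K P θ w k ≤ V k + m ^ 2 := by
    intro k
    have h1 : ∀ ω, (loopOutput K ⬝ᵥ restartVec A B K θ w 0 k ω) ^ 2 =
        1 * (loopOutput K ⬝ᵥ (restartVec A B K θ w 0 k ω - meanVec A B K e μ k)) ^ 2 +
        2 * (loopOutput K ⬝ᵥ meanVec A B K e μ k) *
          (loopOutput K ⬝ᵥ (restartVec A B K θ w 0 k ω - meanVec A B K e μ k)) +
        (loopOutput K ⬝ᵥ meanVec A B K e μ k) ^ 2 := by
      intro ω; rw [dotProduct_sub]; ring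
    rw [outputMoment]
    simp only [h1]
    rw [integral_linear_combination _ _ (hL k).integrable_sq ((hL k).integrable one_le_two)
      (integrable_const _), (h.centered_moments A B K he0 he1 k _).1]
    have := hmean k
    simp only [integral_const, probReal_univ, smul_eq_mul]
    linarith
  have hc : 0 ≤ variance (w 0) P + e * (1 - e) * m ^ 2 :=
    add_nonneg (variance_nonneg _ _) (mul_nonneg hσ (sq_nonneg _))
  have hVle := renewal_bound (fun t => sq_nonneg (impulse A B e K t)) (hN.summable_sq _ _) hσ hg hc
    (V := V) fun k => by
      rw [hV]
      simp only
      rw [(h.centered_moments A B K he0 he1 k _).2]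
      refine Finset.sum_le_sum fun j _ => mul_le_mul_of_nonneg_left ?_ (sq_nonneg _)
      have := mul_le_mul_of_nonneg_left (hU j) hσ
      change _ + e * (1 - e) * outputMoment A B K P θ w j ≤ _
      linarith
  set D := (∑' t, impulse A B e K t ^ 2) * (variance (w 0) P + e * (1 - e) * m ^ 2) /
    (1 - e * (1 - e) * ∑' t, impulse A B e K t ^ 2) with hD
  refine ⟨max D (e * (1 - e) * (D + m ^ 2)), fun k => ⟨?_, ?_⟩⟩
  · refine le_trans ?_ ((hVle k).trans (le_max_left _ _))
    have h1 : (fun ω => ctrl A B K (fun j => θ j ω) (fun j => w j ω) k) = fun ω =>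
        loopOutput K ⬝ᵥ (restartVec A B K θ w 0 k ω - meanVec A B K e μ k) +
          loopOutput K ⬝ᵥ meanVec A B K e μ k := by
      funext ω
      rw [ctrl_eq_restartVec, dotProduct_sub, sub_add_cancel]
    rw [h1, variance_add_const (hL k).aestronglyMeasurable]
    exact variance_le_expectation_sq (hL k).aestronglyMeasurable
  · rw [h.variance_residual he0 he1]
    refine le_trans (mul_le_mul_of_nonneg_left ((hU k).trans ?_) hσ) (le_max_right _ _)
    have := hVle k
    linarith

end Stability

/-! ### A law of large numbers by blocks. -/

section Averages

variable {Ω : Type*} [mΩ : MeasurableSpace Ω] {P : Measure Ω} [IsProbabilityMeasure P]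

/-- A law of large numbers by blocks: if the sums of `X` over consecutive blocks of some length `m`
are `m ε`-close in `L¹` to variables that obey the law of large numbers, for every `ε`, then the
averages of `X` converge in `L¹`. -/
lemma tendsto_integral_abs_average {X : ℕ → Ω → ℝ} (hX : ∀ k, Integrable (X k) P) {C J : ℝ}
    (hC : ∀ k, ∫ ω, |X k ω| ∂P ≤ C)
    (hblock : ∀ ε > 0, ∃ m : ℕ, 0 < m ∧ ∃ (W : ℕ → Ω → ℝ) (c : ℝ), (∀ l, Integrable (W l) P) ∧
      (∀ l, ∫ ω, |∑ r ∈ Finset.range m, X (r + m * l) ω - W l ω| ∂P ≤ m * ε) ∧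
      |c - m * J| ≤ m * ε ∧
      Tendsto (fun l : ℕ => ∫ ω, |(l : ℝ)⁻¹ * ∑ i ∈ Finset.range l, W i ω - c| ∂P) atTop (𝓝 0)) :
    Tendsto (fun M : ℕ => ∫ ω, |(∑ k ∈ Finset.range M, X k ω) / M - J| ∂P) atTop (𝓝 0) := by
  rw [Metric.tendsto_atTop]
  intro ε hε
  -- There are four errors, each at most ε/5: block approximation, law of large numbers, the value
  -- of c, and the incomplete last block, which contributes at most R in total.
  obtain ⟨m, hm, W, c, hWi, hWX, hc, hW⟩ := hblock (ε / 5) (by positivity)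
  rw [Metric.tendsto_atTop] at hW
  obtain ⟨L, hL⟩ := hW (ε / 5) (by positivity)
  have hC0 : 0 ≤ C := (integral_nonneg fun _ => abs_nonneg _).trans (hC 0)
  set R := m * (C + |J|) with hR
  have hR0 : 0 ≤ R := by positivity
  obtain ⟨M₁, hM₁⟩ := exists_nat_gt (R / (ε / 5))
  refine ⟨max (m * (L + 1)) M₁, fun M hM => ?_⟩
  have hM1 : m * (L + 1) ≤ M := (le_max_left _ _).trans hM
  have hM2 : (M₁ : ℝ) ≤ M := by exact_mod_cast (le_max_right _ _).trans hM
  have hMpos : (0 : ℝ) < M := by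
    have : 0 < m * (L + 1) := by positivity
    exact_mod_cast this.trans_le hM1
  set l := M / m with hl
  set t := M % m with ht
  have hMlt : m * l + t = M := Nat.div_add_mod M m
  have htm : t < m := Nat.mod_lt _ hm
  have hlL : L + 1 ≤ l := (Nat.le_div_iff_mul_le hm).2 (by rw [mul_comm]; exact hM1)
  have hl0 : (0 : ℝ) < l := by exact_mod_cast (Nat.succ_pos L).trans_le hlL
  have hlm : (l : ℝ) * m ≤ M := by
    have : m * l ≤ M := by omega
    rw [mul_comm]; exact_mod_cast this
  have hlM : (l : ℝ) ≤ M := by exact_mod_cast Nat.div_le_self M m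
  set D : ℕ → Ω → ℝ := fun i ω => ∑ r ∈ Finset.range m, X (r + m * i) ω - W i ω with hD
  set E : Ω → ℝ := fun ω => (l : ℝ)⁻¹ * ∑ i ∈ Finset.range l, W i ω - c with hE
  have hDi : ∀ i, Integrable (D i) P := fun i =>
    (integrable_finsetSum _ fun r _ => hX _).sub (hWi i)
  have hEi : Integrable E P :=
    ((integrable_finsetSum _ fun i _ => hWi i).const_mul _).sub (integrable_const _)
  have hsum : ∀ (q : ℕ) (ω : Ω), ∑ k ∈ Finset.range (m * q), X k ω =
      ∑ i ∈ Finset.range q, ∑ r ∈ Finset.range m, X (r + m * i) ω := by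
    intro q ω
    induction q with
    | zero => simp
    | succ q ih =>
      rw [Nat.mul_succ, Finset.sum_range_add, ih, Finset.sum_range_succ]
      congr 1
      exact Finset.sum_congr rfl fun r _ => by rw [add_comm]
  have hpt : ∀ ω, |∑ k ∈ Finset.range M, X k ω - M * J| ≤
      ∑ i ∈ Finset.range l, |D i ω| + l * |E ω| + l * |c - m * J| +
        ∑ r ∈ Finset.range t, (|X (m * l + r) ω| + |J|) := by
    intro ω
    have h1 : ∑ k ∈ Finset.range M, X k ω - M * J = ∑ i ∈ Finset.range l, D i ω + l * E ω +
        l * (c - m * J) + ∑ r ∈ Finset.range t, (X (m * l + r) ω - J) := by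
      have hcast : (M : ℝ) = m * l + t := by exact_mod_cast hMlt.symm
      have h2 : (l : ℝ) * E ω = ∑ i ∈ Finset.range l, W i ω - l * c := by
        rw [hE]; field_simp
      rw [h2, hcast]
      nth_rewrite 1 [← hMlt]
      rw [Finset.sum_range_add, hsum]
      simp only [hD, Finset.sum_sub_distrib, Finset.sum_const, Finset.card_range, nsmul_eq_mul]
      ring
    rw [h1]
    refine (abs_add_le _ _).trans (add_le_add ((abs_add_le _ _).trans
      (add_le_add ((abs_add_le _ _).trans (add_le_add (Finset.abs_sum_le_sum_abs _ _) ?_)) ?_)) ?_)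
    · rw [abs_mul, abs_of_pos hl0]
    · rw [abs_mul, abs_of_pos hl0]
    · exact (Finset.abs_sum_le_sum_abs _ _).trans (Finset.sum_le_sum fun r _ => abs_sub _ _)
  have hi1 : Integrable (fun ω => ∑ i ∈ Finset.range l, |D i ω|) P :=
    integrable_finsetSum _ fun i _ => (hDi i).abs
  have hi2 : Integrable (fun ω => (l : ℝ) * |E ω|) P := hEi.abs.const_mul _
  have hi3 : Integrable (fun ω => ∑ r ∈ Finset.range t, (|X (m * l + r) ω| + |J|)) P :=
    integrable_finsetSum _ fun r _ => (hX _).abs.add (integrable_const _)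
  have hi12 : Integrable (fun ω => ∑ i ∈ Finset.range l, |D i ω| + l * |E ω|) P := hi1.add hi2
  have hi123 : Integrable
      (fun ω => ∑ i ∈ Finset.range l, |D i ω| + l * |E ω| + l * |c - m * J|) P :=
    hi12.add (integrable_const _)
  have hI1 : ∫ ω, ∑ i ∈ Finset.range l, |D i ω| ∂P ≤ l * (m * (ε / 5)) := by
    rw [integral_finsetSum _ fun i _ => (hDi i).abs]
    refine (Finset.sum_le_sum fun i _ => hWX i).trans (le_of_eq ?_)
    rw [Finset.sum_const, Finset.card_range, nsmul_eq_mul]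
  have hI2 : ∫ ω, |E ω| ∂P ≤ ε / 5 := by
    have := hL l (by omega)
    rw [Real.dist_eq, sub_zero, abs_of_nonneg (integral_nonneg fun _ => abs_nonneg _)] at this
    exact this.le
  have hI3 : ∫ ω, ∑ r ∈ Finset.range t, (|X (m * l + r) ω| + |J|) ∂P ≤ R := by
    have hXJ : ∀ r, Integrable (fun ω => |X (m * l + r) ω| + |J|) P :=
      fun r => (hX _).abs.add (integrable_const _)
    rw [integral_finsetSum _ fun r _ => hXJ r]
    have : ∀ r ∈ Finset.range t, ∫ ω, (|X (m * l + r) ω| + |J|) ∂P ≤ C + |J| := by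
      intro r _
      rw [integral_add (hX _).abs (integrable_const _)]
      simp only [integral_const, probReal_univ, one_smul]
      have := hC (m * l + r)
      linarith
    refine (Finset.sum_le_sum this).trans ?_
    rw [Finset.sum_const, Finset.card_range, nsmul_eq_mul, hR]
    have htm' : (t : ℝ) ≤ m := by exact_mod_cast htm.le
    exact mul_le_mul_of_nonneg_right htm' (by positivity)
  have hmain : ∫ ω, |∑ k ∈ Finset.range M, X k ω - M * J| ∂P ≤
      l * (m * (ε / 5)) + l * (ε / 5) + l * (m * (ε / 5)) + R := by
    refine (integral_mono (((integrable_finsetSum _ fun k _ => hX k).sub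
      (integrable_const _)).abs) (hi123.add hi3) hpt).trans ?_
    simp only [Pi.add_apply]
    rw [integral_add hi123 hi3, integral_add hi12 (integrable_const _), integral_add hi1 hi2,
      integral_const_mul]
    simp only [integral_const, probReal_univ, one_smul]
    have h1 := mul_le_mul_of_nonneg_left hI2 hl0.le
    have h2 := mul_le_mul_of_nonneg_left hc hl0.le
    linarith
  have hdiv : ∀ ω, |(∑ k ∈ Finset.range M, X k ω) / M - J| =
      |∑ k ∈ Finset.range M, X k ω - M * J| / M := by
    intro ω
    rw [← abs_of_pos hMpos, ← abs_div, abs_of_pos hMpos]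
    congr 1
    field_simp
  rw [Real.dist_eq, sub_zero, abs_of_nonneg (integral_nonneg fun _ => abs_nonneg _)]
  simp only [hdiv]
  rw [integral_div, div_lt_iff₀ hMpos]
  have hRM : R < ε / 5 * M := by
    have h1 : R / (ε / 5) < M := hM₁.trans_le hM2
    rw [div_lt_iff₀ (by positivity)] at h1
    linarith
  have h1 : (l : ℝ) * (m * (ε / 5)) ≤ M * (ε / 5) := by
    rw [← mul_assoc]
    exact mul_le_mul_of_nonneg_right hlm (by positivity)
  have h2 : (l : ℝ) * (ε / 5) ≤ M * (ε / 5) := mul_le_mul_of_nonneg_right hlM (by positivity)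
  have h3 : 0 < ε * M := by positivity
  linarith

omit [IsProbabilityMeasure P] in
lemma integral_abs_eq_toReal_eLpNorm {f : Ω → ℝ} (hf : AEStronglyMeasurable f P) :
    ∫ ω, |f ω| ∂P = (eLpNorm f 1 P).toReal := by
  rw [eLpNorm_one_eq_lintegral_enorm, ← integral_norm_eq_lintegral_enorm hf]
  rfl

end Averages

/-! ### Block sums of the power in restarted loops. -/

section Power

open Matrix

variable {n : ℕ} {A : Matrix (Fin n) (Fin n) ℝ} {B : Fin n → ℝ} {e : ℝ} {K : Controller n}
  {Ω : Type*} {θ w : ℕ → Ω → ℝ}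

/-- The power of the corrupted control at time `k + i` in the loop restarted at time `i`. -/
def restartPower (A : Matrix (Fin n) (Fin n) ℝ) (B : Fin n → ℝ) (K : Controller n)
    (θ w : ℕ → Ω → ℝ) (i k : ℕ) (ω : Ω) : ℝ :=
  θ (k + i) ω ^ 2 * (loopOutput K ⬝ᵥ restartVec A B K θ w i k ω) ^ 2

lemma corruptedCtrl_sq (k : ℕ) (ω : Ω) :
    corruptedCtrl A B K (fun j => θ j ω) (fun j => w j ω) k ^ 2 =
      restartPower A B K θ w 0 k ω := by
  rw [corruptedCtrl, ctrl_eq_restartVec, restartPower, mul_pow]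
  rfl

/-- The restarted power summed over a block of length `m`, as a function of the noise path. -/
def blockFun (A : Matrix (Fin n) (Fin n) ℝ) (B : Fin n → ℝ) (K : Controller n) (m : ℕ)
    (x : ℕ ⊕ ℕ → ℝ) : ℝ :=
  ∑ r ∈ Finset.range m, x (Sum.inl r) ^ 2 *
    (loopOutput K ⬝ᵥ loopVec A B K (fun j => x (Sum.inl j)) (fun j => x (Sum.inr j)) r) ^ 2

lemma measurable_blockFun (m : ℕ) : Measurable (blockFun A B K m) := by
  refine Finset.measurable_sum _ fun r _ => ((measurable_pi_apply _).pow_const 2).mul ?_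
  have hc : Continuous fun v : Fin n ⊕ Fin K.order → ℝ => loopOutput K ⬝ᵥ v :=
    continuous_const.dotProduct continuous_id
  exact (hc.measurable.comp (measurable_loopVec A B K
    (θ := fun j (x : ℕ ⊕ ℕ → ℝ) => x (Sum.inl j)) (w := fun j x => x (Sum.inr j))
    (fun j _ => measurable_pi_apply _) (fun j _ => measurable_pi_apply _))).pow_const 2

lemma measurable_restartPower (i m : ℕ) {r : ℕ} (hr : r < m) :
    Measurable[noiseAlg θ w (Set.Ico i (m + i))] (restartPower A B K θ w i r) := by
  refine Measurable.mul ?_ ?_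
  · have hmem : r + i ∈ Set.Ico i (m + i) := ⟨by omega, by omega⟩
    exact (measurable_channel_noiseAlg hmem).pow_const 2
  · exact ((measurable_output i r).mono
      (noiseAlg_mono (Set.Ico_subset_Ico_right (by omega))) le_rfl).pow_const 2

variable [mΩ : MeasurableSpace Ω] {P : Measure Ω} [IsProbabilityMeasure P]
  (h : IsEnvironment P e θ w) (he0 : 0 ≤ e) (he1 : e ≤ 1)
include h he0 he1

lemma IsEnvironment.integrable_restartPower (i k : ℕ) :
    Integrable (restartPower A B K θ w i k) P := by
  have hb : MemLp (fun ω => loopOutput K ⬝ᵥ restartVec A B K θ w i k ω) 2 P :=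
    memLp_dotProduct _ (h.memLp_restartVec A B K he0 he1 i k)
  have h2 := (h.memLp_channel_mul he0 he1 (k + i) hb).add (hb.const_mul (1 - e))
  have h3 : Integrable (fun ω => (θ (k + i) ω *
      (loopOutput K ⬝ᵥ restartVec A B K θ w i k ω)) ^ 2) P := by
    refine (h2.integrable_sq).congr (Eventually.of_forall fun ω => ?_)
    simp only [Pi.add_apply]
    ring
  simp only [mul_pow] at h3
  exact h3

/-- The block sums are one function, `blockFun`, of shifted noise and depend on disjoint time
windows. They are thus identically distributed and pairwise independent, and the L¹ strong law needs
only their integrability. -/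
lemma IsEnvironment.tendsto_block_average (m : ℕ) :
    Tendsto (fun l : ℕ => ∫ ω, |(l : ℝ)⁻¹ * ∑ i ∈ Finset.range l,
        ∑ r ∈ Finset.range m, restartPower A B K θ w (m * i) r ω -
        ∑ r ∈ Finset.range m, ∫ ω, restartPower A B K θ w 0 r ω ∂P| ∂P) atTop (𝓝 0) := by
  set W : ℕ → Ω → ℝ := fun l ω => ∑ r ∈ Finset.range m, restartPower A B K θ w (m * l) r ω with hW
  have hWi : ∀ l, Integrable (W l) P := fun l =>
    integrable_finsetSum _ fun r _ => h.integrable_restartPower he0 he1 _ _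
  have hid : ∀ l, IdentDistrib (W l) (W 0) P P := fun l =>
    (((h.identDistrib_shift he0 he1 (m * l)).trans
      (h.identDistrib_shift he0 he1 (m * 0)).symm).comp
        (measurable_blockFun (A := A) (B := B) (K := K) m))
  have hWm : ∀ l, Measurable[noiseAlg θ w (Set.Ico (m * l) (m + m * l))] (W l) := fun l =>
    Finset.measurable_sum _ fun r hr => measurable_restartPower _ m (Finset.mem_range.1 hr)
  have hdisj : ∀ i j, i < j →
      Disjoint (Set.Ico (m * i) (m + m * i)) (Set.Ico (m * j) (m + m * j)) := by
    intro i j hij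
    rw [Set.disjoint_left]
    rintro x ⟨_, hx1⟩ ⟨hx2, _⟩
    have : m * (i + 1) ≤ m * j := Nat.mul_le_mul_left m hij
    rw [Nat.mul_succ] at this
    omega
  have hind : Pairwise fun i j => IndepFun (W i) (W j) P := by
    intro i j hij
    rcases lt_or_gt_of_ne hij with hij | hij
    · exact h.indepFun_of_disjoint (hdisj i j hij) (hWm i) (hWm j)
    · exact (h.indepFun_of_disjoint (hdisj j i hij) (hWm j) (hWm i)).symm
  have hlaw := strong_law_Lp (μ := P) le_rfl ENNReal.one_ne_top W (memLp_one_iff_integrable.2 (hWi 0))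
    hind hid
  have hmean : ∫ ω, W 0 ω ∂P = ∑ r ∈ Finset.range m, ∫ ω, restartPower A B K θ w 0 r ω ∂P := by
    rw [hW]
    simp only [mul_zero]
    exact integral_finsetSum _ fun r _ => h.integrable_restartPower he0 he1 0 r
  have hreal := (ENNReal.tendsto_toReal ENNReal.zero_ne_top).comp hlaw
  rw [ENNReal.toReal_zero] at hreal
  refine hreal.congr fun l => ?_
  rw [← hmean, Function.comp_apply, ← integral_abs_eq_toReal_eLpNorm]
  · rfl
  · exact (((integrable_finsetSum _ fun i _ => hWi i).const_mul _).sub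
      (integrable_const _)).aestronglyMeasurable

end Power

/-! ### Existence, value and uniqueness of the average power. -/

section AveragePower

open Matrix

variable {n : ℕ} {A : Matrix (Fin n) (Fin n) ℝ} {B : Fin n → ℝ} {e : ℝ} {K : Controller n}

section Standard

variable {Ω : Type*} {θ w : ℕ → Ω → ℝ} [mΩ : MeasurableSpace Ω] {P : Measure Ω}
  [IsProbabilityMeasure P] (h : IsEnvironment P e θ w) (he0 : 0 ≤ e) (he1 : e ≤ 1)
  (h0 : ∫ ω, w 0 ω ∂P = 0) (h1 : variance (w 0) P = 1)
  (hN : SchurStable (nominalMatrix A B K e)) (hg : e * (1 - e) * gain A B e K < 1)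
include h he0 he1 h0 h1 hN hg

lemma IsEnvironment.outputMoment_le (k : ℕ) :
    outputMoment A B K P θ w k ≤ gain A B e K / (1 - e * (1 - e) * gain A B e K) := by
  have := renewal_bound (fun t => sq_nonneg (impulse A B e K t)) (hN.summable_sq _ _)
    (erasure_variance_nonneg he0 he1) hg zero_le_one
    (fun k => (h.outputMoment_renewal he0 he1 h0 h1 k).le) k
  rwa [mul_one] at this

lemma IsEnvironment.tendsto_outputMoment :
    Tendsto (outputMoment A B K P θ w) atTop
      (𝓝 (gain A B e K / (1 - e * (1 - e) * gain A B e K))) :=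
  (renewal_tendsto (fun t => sq_nonneg (impulse A B e K t)) (hN.summable_sq _ _)
    (erasure_variance_nonneg he0 he1) (h.outputMoment_renewal he0 he1 h0 h1)
    (h.outputMoment_le he0 he1 h0 h1 hN hg)).2

lemma IsEnvironment.exists_state_bound :
    ∃ C : ℝ, 0 ≤ C ∧ ∀ k, ∑ a, ∫ ω, restartVec A B K θ w 0 k ω a ^ 2 ∂P ≤ C := by
  have hσ := erasure_variance_nonneg he0 he1
  set CU := gain A B e K / (1 - e * (1 - e) * gain A B e K) with hCU
  have hCU0 : 0 ≤ CU := div_nonneg gain_nonneg (by linarith)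
  refine ⟨∑ a : Fin n ⊕ Fin K.order, (∑' t, ((Pi.single a 1 : Fin n ⊕ Fin K.order → ℝ) ⬝ᵥ
    ((nominalMatrix A B K e ^ t) *ᵥ loopInput B K)) ^ 2) * (1 + e * (1 - e) * CU),
    Finset.sum_nonneg fun a _ => mul_nonneg (tsum_nonneg fun _ => sq_nonneg _)
      (by have := mul_nonneg hσ hCU0; linarith), fun k => Finset.sum_le_sum fun a _ => ?_⟩
  have hF := h.integral_sq_standard (A := A) (B := B) (K := K) he0 he1 h0 h1 k (Pi.single a 1)
  simp only [single_one_dotProduct] at hF ⊢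
  rw [hF]
  calc ∑ j ∈ Finset.range k, ((nominalMatrix A B K e ^ (k - 1 - j)) *ᵥ loopInput B K) a ^ 2 *
        (1 + e * (1 - e) * outputMoment A B K P θ w j)
      ≤ ∑ j ∈ Finset.range k, ((nominalMatrix A B K e ^ (k - 1 - j)) *ᵥ loopInput B K) a ^ 2 *
        (1 + e * (1 - e) * CU) := by
        refine Finset.sum_le_sum fun j _ => mul_le_mul_of_nonneg_left ?_ (sq_nonneg _)
        have := mul_le_mul_of_nonneg_left (h.outputMoment_le he0 he1 h0 h1 hN hg j) hσ
        linarith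
    _ = (∑ j ∈ Finset.range k, ((nominalMatrix A B K e ^ j) *ᵥ loopInput B K) a ^ 2) *
        (1 + e * (1 - e) * CU) := by
        rw [← Finset.sum_mul, Finset.sum_range_reflect
          (fun j => ((nominalMatrix A B K e ^ j) *ᵥ loopInput B K) a ^ 2)]
    _ ≤ _ := by
        refine mul_le_mul_of_nonneg_right ?_ (by have := mul_nonneg hσ hCU0; linarith)
        have hs := hN.summable_sq (loopInput B K) (Pi.single a 1)
        simp only [single_one_dotProduct] at hs
        exact hs.sum_le_tsum _ fun _ _ => sq_nonneg _

/-- The mean-square error of the restarted output is summable, uniformly in the restart time. -/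
lemma IsEnvironment.exists_restart_error_bound :
    ∃ C : ℝ, 0 ≤ C ∧ ∀ i m, ∑ k ∈ Finset.range m, ∫ ω, (loopOutput K ⬝ᵥ
      (restartVec A B K θ w 0 (k + i) ω - restartVec A B K θ w i k ω)) ^ 2 ∂P ≤ C := by
  obtain ⟨Cz, hCz0, hCz⟩ := h.exists_state_bound he0 he1 h0 h1 hN hg
  set N := nominalMatrix A B K e with hNd
  -- Cauchy–Schwarz bound on the free response; it does not depend on the restart time because the
  -- state has bounded second moments.
  set γ : ℕ → ℝ := fun k => (∑ a, (loopOutput K ⬝ᵥ ((N ^ k) *ᵥ Pi.single a 1)) ^ 2) * Cz with hγ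
  have hγ0 : ∀ k, 0 ≤ γ k := fun k =>
    mul_nonneg (Finset.sum_nonneg fun _ _ => sq_nonneg _) hCz0
  have hγs : Summable γ :=
    (summable_sum fun a _ => hN.summable_sq (Pi.single a 1) (loopOutput K)).mul_right Cz
  have hσ := erasure_variance_nonneg he0 he1
  refine ⟨(∑' k, γ k) / (1 - e * (1 - e) * gain A B e K),
    div_nonneg (tsum_nonneg hγ0) (by linarith), fun i m => ?_⟩
  refine sum_renewal_le (fun t => sq_nonneg (impulse A B e K t)) (hN.summable_sq _ _) hσ hg hγ0 hγs
    (fun k => integral_nonneg fun _ => sq_nonneg _) (fun k => ?_) m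
  rw [h.restart_error A B K he0 he1 i k]
  refine add_le_add ?_ le_rfl
  have hL := h.memLp_restartVec A B K he0 he1 0 i
  have hpt : ∀ ω, (loopOutput K ⬝ᵥ ((N ^ k) *ᵥ restartVec A B K θ w 0 i ω)) ^ 2 ≤
      (∑ a, (loopOutput K ⬝ᵥ ((N ^ k) *ᵥ Pi.single a 1)) ^ 2) *
        ∑ a, restartVec A B K θ w 0 i ω a ^ 2 := by
    intro ω
    rw [dotProduct_mulVec]
    have : ∀ a, loopOutput K ⬝ᵥ ((N ^ k) *ᵥ Pi.single a 1) = (loopOutput K ᵥ* (N ^ k)) a := by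
      intro a
      rw [dotProduct_mulVec, dotProduct_single_one]
    simp only [this]
    exact Finset.sum_mul_sq_le_sq_mul_sq _ _ _
  have hsq : ∀ a, Integrable (fun ω => restartVec A B K θ w 0 i ω a ^ 2) P :=
    fun a => (hL a).integrable_sq
  refine (integral_mono ?_ ((integrable_finsetSum _ fun a _ => hsq a).const_mul _) hpt).trans ?_
  · simp only [dotProduct_mulVec]
    exact (memLp_dotProduct _ hL).integrable_sq
  · rw [integral_const_mul, integral_finsetSum _ fun a _ => hsq a]
    exact mul_le_mul_of_nonneg_left (hCz i) (Finset.sum_nonneg fun _ _ => sq_nonneg _)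

omit h0 h1 hN hg in
-- Young's inequality for u² - (u - D)², with θ² ≤ 1. A small t controls the term in u², and the
-- term in D² has a bounded sum over any block.
lemma IsEnvironment.restartPower_error_le (i k : ℕ) {t : ℝ} (ht : 0 < t) :
    ∫ ω, |restartPower A B K θ w 0 (k + i) ω - restartPower A B K θ w i k ω| ∂P ≤
      t * outputMoment A B K P θ w (k + i) + (1 + 1 / t) * ∫ ω, (loopOutput K ⬝ᵥ
        (restartVec A B K θ w 0 (k + i) ω - restartVec A B K θ w i k ω)) ^ 2 ∂P := by
  set D : Ω → ℝ := fun ω => loopOutput K ⬝ᵥ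
    (restartVec A B K θ w 0 (k + i) ω - restartVec A B K θ w i k ω) with hD
  have hu := (h.memLp_output (A := A) (B := B) (K := K) he0 he1 (k + i)).integrable_sq
  have hDi : Integrable (fun ω => D ω ^ 2) P :=
    (memLp_dotProduct _ fun a => (h.memLp_restartVec A B K he0 he1 0 (k + i) a).sub
      (h.memLp_restartVec A B K he0 he1 i k a)).integrable_sq
  have hpt : ∀ᵐ ω ∂P, |restartPower A B K θ w 0 (k + i) ω - restartPower A B K θ w i k ω| ≤
      t * (loopOutput K ⬝ᵥ restartVec A B K θ w 0 (k + i) ω) ^ 2 + (1 + 1 / t) * D ω ^ 2 := by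
    filter_upwards [h.channel_ae he0 he1 (k + i)] with ω hω
    set u := loopOutput K ⬝ᵥ restartVec A B K θ w 0 (k + i) ω with hu
    have hv : loopOutput K ⬝ᵥ restartVec A B K θ w i k ω = u - D ω := by
      rw [hD, hu]; simp only [dotProduct_sub]; ring
    have hbound : |u ^ 2 - (u - D ω) ^ 2| ≤ t * u ^ 2 + (1 + 1 / t) * D ω ^ 2 := by
      have h3 : 2 * (u * D ω) ≤ t * u ^ 2 + 1 / t * D ω ^ 2 := by
        have h4 : t * u ^ 2 + 1 / t * D ω ^ 2 - 2 * (u * D ω) = (t * u - D ω) ^ 2 / t := by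
          field_simp
          ring
        have h5 : 0 ≤ (t * u - D ω) ^ 2 / t := by positivity
        linarith
      have h3' : -(2 * (u * D ω)) ≤ t * u ^ 2 + 1 / t * D ω ^ 2 := by
        have h4 : t * u ^ 2 + 1 / t * D ω ^ 2 + 2 * (u * D ω) = (t * u + D ω) ^ 2 / t := by
          field_simp
          ring
        have h5 : 0 ≤ (t * u + D ω) ^ 2 / t := by positivity
        linarith
      have h6 := sq_nonneg (D ω)
      rw [abs_le]
      constructor <;> linarith
    have hr : restartPower A B K θ w 0 (k + i) ω - restartPower A B K θ w i k ω =
        θ (k + i) ω ^ 2 * (u ^ 2 - (u - D ω) ^ 2) := by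
      rw [restartPower, restartPower, hv]
      simp only [add_zero]
      ring
    rw [hr, abs_mul]
    refine le_trans (mul_le_of_le_one_left (abs_nonneg _) ?_) hbound
    rcases hω with hω | hω <;> rw [hω] <;> norm_num
  refine (integral_mono_ae ((h.integrable_restartPower he0 he1 0 (k + i)).sub
    (h.integrable_restartPower he0 he1 i k)).abs
    ((hu.const_mul t).add (hDi.const_mul (1 + 1 / t))) hpt).trans (le_of_eq ?_)
  simp only [Pi.add_apply]
  rw [integral_add (hu.const_mul t) (hDi.const_mul _), integral_const_mul, integral_const_mul]
  rfl

lemma IsEnvironment.tendsto_average_power :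
    Tendsto (fun M : ℕ => ∫ ω, |(∑ k ∈ Finset.range M, restartPower A B K θ w 0 k ω) / M -
      (1 - e) * (gain A B e K / (1 - e * (1 - e) * gain A B e K))| ∂P) atTop (𝓝 0) := by
  set CU := gain A B e K / (1 - e * (1 - e) * gain A B e K) with hCU
  have hCU0 : 0 ≤ CU := div_nonneg gain_nonneg (by linarith)
  have hmean : ∀ k, ∫ ω, restartPower A B K θ w 0 k ω ∂P =
      (1 - e) * outputMoment A B K P θ w k := fun k =>
    h.integral_channel_sq_mul he0 he1 (notMem_Ico_add 0 k)
      ((measurable_output (A := A) (B := B) (K := K) 0 k).pow_const 2)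
  have hUle := h.outputMoment_le he0 he1 h0 h1 hN hg
  obtain ⟨CD, hCD0, hCD⟩ := h.exists_restart_error_bound he0 he1 h0 h1 hN hg
  refine tendsto_integral_abs_average (fun k => h.integrable_restartPower he0 he1 0 k)
    (C := (1 - e) * CU) (fun k => ?_) fun ε hε => ?_
  · have : ∀ ω, |restartPower A B K θ w 0 k ω| = restartPower A B K θ w 0 k ω := fun ω =>
      abs_of_nonneg (mul_nonneg (sq_nonneg _) (sq_nonneg _))
    simp only [this]
    rw [hmean]
    exact mul_le_mul_of_nonneg_left (hUle k) (by linarith)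
  -- First t is fixed to keep the u² term below ε/2 per step. Then m is taken so large that the
  -- total D² error is below m·ε/2 and the Cesàro mean of the expected powers is within ε of its
  -- limit.
  · set t := ε / (2 * (CU + 1)) with ht
    have ht0 : 0 < t := by positivity
    have htCU : t * CU ≤ ε / 2 := by
      rw [ht, div_mul_eq_mul_div, div_le_div_iff₀ (by positivity) two_pos]
      nlinarith
    have hces := ((h.tendsto_outputMoment he0 he1 h0 h1 hN hg).const_mul (1 - e)).cesaro
    rw [Metric.tendsto_atTop] at hces
    obtain ⟨m₁, hm₁⟩ := hces ε hε
    obtain ⟨m₂, hm₂⟩ := exists_nat_gt ((1 + 1 / t) * CD / (ε / 2))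
    refine ⟨max (m₁ + 1) m₂, by positivity, fun l ω =>
      ∑ r ∈ Finset.range (max (m₁ + 1) m₂),
        restartPower A B K θ w (max (m₁ + 1) m₂ * l) r ω,
      ∑ r ∈ Finset.range (max (m₁ + 1) m₂), ∫ ω, restartPower A B K θ w 0 r ω ∂P,
      fun l => integrable_finsetSum _ fun r _ => h.integrable_restartPower he0 he1 _ _,
      fun l => ?_, ?_, h.tendsto_block_average he0 he1 _⟩
    · set m := max (m₁ + 1) m₂ with hm
      have hi : ∀ r, Integrable (fun ω => |restartPower A B K θ w 0 (r + m * l) ω -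
          restartPower A B K θ w (m * l) r ω|) P := fun r =>
        ((h.integrable_restartPower he0 he1 0 _).sub (h.integrable_restartPower he0 he1 _ _)).abs
      have hm₂' : (1 + 1 / t) * CD ≤ m * (ε / 2) := by
        rw [div_lt_iff₀ (by positivity)] at hm₂
        refine hm₂.le.trans (mul_le_mul_of_nonneg_right ?_ (by positivity))
        exact_mod_cast le_max_right _ _
      calc ∫ ω, |∑ r ∈ Finset.range m, restartPower A B K θ w 0 (r + m * l) ω -
            ∑ r ∈ Finset.range m, restartPower A B K θ w (m * l) r ω| ∂P
          ≤ ∫ ω, ∑ r ∈ Finset.range m, |restartPower A B K θ w 0 (r + m * l) ω -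
              restartPower A B K θ w (m * l) r ω| ∂P := by
            refine integral_mono ?_ (integrable_finsetSum _ fun r _ => hi r) fun ω => ?_
            · exact ((integrable_finsetSum _ fun r _ => h.integrable_restartPower he0 he1 _ _).sub
                (integrable_finsetSum _ fun r _ => h.integrable_restartPower he0 he1 _ _)).abs
            · simp only
              rw [← Finset.sum_sub_distrib]
              exact Finset.abs_sum_le_sum_abs _ _
        _ = ∑ r ∈ Finset.range m, ∫ ω, |restartPower A B K θ w 0 (r + m * l) ω -
              restartPower A B K θ w (m * l) r ω| ∂P := integral_finsetSum _ fun r _ => hi r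
        _ ≤ ∑ r ∈ Finset.range m, (t * CU + (1 + 1 / t) * ∫ ω, (loopOutput K ⬝ᵥ
              (restartVec A B K θ w 0 (r + m * l) ω - restartVec A B K θ w (m * l) r ω)) ^ 2 ∂P) :=
            Finset.sum_le_sum fun r _ => (h.restartPower_error_le he0 he1 (m * l) r ht0).trans
              (add_le_add (mul_le_mul_of_nonneg_left (hUle _) ht0.le) le_rfl)
        _ = m * (t * CU) + (1 + 1 / t) * ∑ r ∈ Finset.range m, ∫ ω, (loopOutput K ⬝ᵥ
              (restartVec A B K θ w 0 (r + m * l) ω - restartVec A B K θ w (m * l) r ω)) ^ 2 ∂P := by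
            rw [Finset.sum_add_distrib, Finset.sum_const, Finset.card_range, nsmul_eq_mul,
              ← Finset.mul_sum]
        _ ≤ m * (ε / 2) + m * (ε / 2) := by
            refine add_le_add (mul_le_mul_of_nonneg_left htCU (Nat.cast_nonneg _)) ?_
            exact (mul_le_mul_of_nonneg_left (hCD _ _) (by positivity)).trans hm₂'
        _ = m * ε := by ring
    · set m := max (m₁ + 1) m₂ with hm
      have hm0 : (0 : ℝ) < m := by
        have : 0 < m := lt_of_lt_of_le (Nat.succ_pos m₁) (le_max_left _ _)
        exact_mod_cast this
      have := (hm₁ m ((Nat.le_succ m₁).trans (le_max_left _ _))).le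
      rw [Real.dist_eq] at this
      simp only [hmean]
      have hx : ∑ r ∈ Finset.range m, (1 - e) * outputMoment A B K P θ w r - m * ((1 - e) * CU) =
          m * ((m : ℝ)⁻¹ * ∑ r ∈ Finset.range m, (1 - e) * outputMoment A B K P θ w r -
            (1 - e) * CU) := by
        field_simp
      rw [hx, abs_mul, abs_of_pos hm0]
      exact mul_le_mul_of_nonneg_left this hm0.le

end Standard

/-- The average power of the corrupted control in a mean-square stable loop. -/
theorem hasAveragePower_of_gain_lt (he0 : 0 ≤ e) (he1 : e ≤ 1)
    (hN : SchurStable (nominalMatrix A B K e)) (hg : e * (1 - e) * gain A B e K < 1) :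
    HasAveragePower A B e K
      ((1 - e) * (gain A B e K / (1 - e * (1 - e) * gain A B e K))) := by
  intro Ω _ P _ θ w h h0 h1
  set J := (1 - e) * (gain A B e K / (1 - e * (1 - e) * gain A B e K)) with hJ
  refine ⟨fun _ => J, integrable_const _, ?_, by simp⟩
  have hlim := (h.tendsto_average_power he0 he1 h0 h1 hN hg).comp (tendsto_add_atTop_nat 1)
  have hlim' := (ENNReal.tendsto_ofReal hlim)
  rw [ENNReal.ofReal_zero] at hlim'
  refine hlim'.congr fun N => ?_
  have hfun : (fun ω => timeAverage A B K (fun j => θ j ω) (fun j => w j ω) N - J) = fun ω =>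
      (∑ k ∈ Finset.range (N + 1), restartPower A B K θ w 0 k ω) / ((N + 1 : ℕ) : ℝ) - J := by
    funext ω
    simp only [timeAverage, corruptedCtrl_sq, Nat.cast_add, Nat.cast_one]
  have hint : Integrable (fun ω => (∑ k ∈ Finset.range (N + 1), restartPower A B K θ w 0 k ω) /
      ((N + 1 : ℕ) : ℝ) - J) P :=
    ((integrable_finsetSum _ fun k _ => h.integrable_restartPower he0 he1 0 k).div_const _).sub
      (integrable_const _)
  rw [hfun, Function.comp_apply, integral_abs_eq_toReal_eLpNorm hint.aestronglyMeasurable,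
    ENNReal.ofReal_toReal]
  exact (memLp_one_iff_integrable.2 hint).2.ne

/-- The average power is unique. -/
theorem HasAveragePower.unique (he0 : 0 ≤ e) (he1 : e ≤ 1) {J J' : ℝ}
    (hJ : HasAveragePower A B e K J) (hJ' : HasAveragePower A B e K J') : J = J' := by
  -- A single environment determines the value, since L¹ convergence carries over to expectations;
  -- without one the property would be vacuous.
  obtain ⟨Ω, mΩ, P, hP, θ, w, h, h0, h1⟩ := exists_environment he0 he1
  obtain ⟨L, hL, hLt, hLJ⟩ := hJ Ω P θ w h h0 h1
  obtain ⟨L', hL', hLt', hLJ'⟩ := hJ' Ω P θ w h h0 h1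
  set T : ℕ → Ω → ℝ := fun N ω => timeAverage A B K (fun j => θ j ω) (fun j => w j ω) N with hT
  have hTi : ∀ N, Integrable (T N) P := by
    intro N
    simp only [hT, timeAverage, corruptedCtrl_sq]
    exact (integrable_finsetSum _ fun k _ => h.integrable_restartPower he0 he1 0 k).div_const _
  have hi : ∀ {L : Ω → ℝ}, Integrable L P →
      Tendsto (fun N => eLpNorm (fun ω => T N ω - L ω) 1 P) atTop (𝓝 0) →
      Tendsto (fun N => ∫ ω, T N ω ∂P) atTop (𝓝 (∫ ω, L ω ∂P)) := fun {L} hL hLt =>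
    tendsto_integral_of_L1' L hL.aestronglyMeasurable (Eventually.of_forall hTi) hLt
  rw [← hLJ, ← hLJ']
  exact tendsto_nhds_unique (hi hL hLt) (hi hL' hLt')

end AveragePower

/-! ### Stabilizability threshold and optimal power. -/

section Optimal

variable {n : ℕ} {A : Matrix (Fin n) (Fin n) ℝ} {B : Fin n → ℝ} {e : ℝ}

lemma meanSquareStable_iff {K : Controller n} (he0 : 0 ≤ e) (he1 : e ≤ 1) :
    MeanSquareStable A B e K ↔
      SchurStable (nominalMatrix A B K e) ∧ e * (1 - e) * gain A B e K < 1 :=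
  ⟨fun hK => ⟨hK.1, hK.gain_lt he0 he1⟩, fun hK => meanSquareStable_of_gain_lt he0 he1 hK.1 hK.2⟩

/-- Without a channel, a plant with unstable poles cannot be stabilized. -/
lemma not_meanSquareStabilizable_one (hA : unstablePoles A ≠ 0) :
    ¬ MeanSquareStabilizable A B 1 := by
  rintro ⟨K, hK, -⟩
  obtain ⟨z, hz⟩ := Multiset.exists_mem_of_ne_zero hA
  have h1 : nominalMatrix A B K 1 = Matrix.fromBlocks A 0 K.Bc K.Ac := by
    simp [nominalMatrix]
  have hzA : z ∈ eigs A := by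
    rw [← unstablePoles_add_stablePoles]
    exact Multiset.mem_add.2 (Or.inl hz)
  refine absurd (hK z ?_) (not_lt.2 (one_le_norm_of_mem_unstablePoles A hz))
  rw [h1, eigs_fromBlocks_zero₁₂]
  exact Multiset.mem_add.2 (Or.inl hzA)

/-- Stabilizing controllers come arbitrarily close to the pole bound. -/
lemma exists_controller_gain_le_add (hAB : Stabilizable A B) (he : e ≠ 1) {δ : ℝ} (hδ : 0 < δ) :
    ∃ K : Controller n, SchurStable (nominalMatrix A B K e) ∧
      (1 - e) ^ 2 * gain A B e K ≤ poleProduct A ^ 2 - 1 + δ := by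
  set f : ℝ → ℝ := fun ρ =>
    ((2 / (1 + ρ)) ^ Multiset.card (unstablePoles A) * poleProduct A) ^ 2 - 1 with hf
  have hcont : ContinuousAt f 1 := by
    have h1 : ContinuousAt (fun ρ : ℝ => 2 / (1 + ρ)) 1 :=
      continuousAt_const.div (continuousAt_const.add continuousAt_id) (by norm_num)
    exact (((h1.pow _).mul continuousAt_const).pow 2).sub continuousAt_const
  have hf1 : f 1 = poleProduct A ^ 2 - 1 := by
    simp only [hf]
    norm_num
  -- The cost of shrinking the reflected poles disappears as ρ tends to 1 from below.
  have hev : ∀ᶠ ρ in 𝓝[<] (1 : ℝ), f ρ < poleProduct A ^ 2 - 1 + δ := by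
    refine (hcont.tendsto.mono_left nhdsWithin_le_nhds).eventually (gt_mem_nhds ?_)
    rw [hf1]
    linarith
  have hpos : ∀ᶠ ρ in 𝓝[<] (1 : ℝ), ρ ∈ Set.Ioo (0 : ℝ) 1 := Ioo_mem_nhdsLT one_pos
  obtain ⟨ρ, h1, h2⟩ := (hev.and hpos).exists
  obtain ⟨K, hK, hg⟩ := exists_controller_gain_le e hAB he h2.1 h2.2.le (Or.inl h2.2)
  exact ⟨K, hK, hg.trans h1.le⟩

lemma exists_controller_gain_le_of_norm_ne_one (hAB : Stabilizable A B) (he : e ≠ 1)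
    (hA : ∀ z ∈ eigs A, ‖z‖ ≠ 1) :
    ∃ K : Controller n, SchurStable (nominalMatrix A B K e) ∧
      (1 - e) ^ 2 * gain A B e K ≤ poleProduct A ^ 2 - 1 := by
  obtain ⟨K, hK, hg⟩ := exists_controller_gain_le e hAB he one_pos le_rfl (Or.inr hA)
  refine ⟨K, hK, hg.trans (le_of_eq ?_)⟩
  norm_num

lemma gain_lt_iff (he : e < 1) {K : Controller n} :
    e * (1 - e) * gain A B e K < 1 ↔ e * ((1 - e) ^ 2 * gain A B e K) < 1 - e := by
  have hc : 0 < 1 - e := by linarith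
  rw [← mul_lt_mul_iff_right₀ hc, mul_one]
  rw [show (1 - e) * (e * (1 - e) * gain A B e K) = e * ((1 - e) ^ 2 * gain A B e K) by ring]

lemma average_power_eq (he : e < 1) (x : ℝ) :
    (1 - e) * (x / (1 - e * (1 - e) * x)) =
      (1 - e) ^ 2 * x / (1 - e - e * ((1 - e) ^ 2 * x)) := by
  have hc : 1 - e ≠ 0 := by linarith
  rw [show 1 - e - e * ((1 - e) ^ 2 * x) = (1 - e) * (1 - e * (1 - e) * x) by ring,
    show (1 - e) ^ 2 * x = (1 - e) * ((1 - e) * x) by ring, mul_div_mul_left _ _ hc, mul_div_assoc]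

/-- Used with x = (1-e)²·`gain`: minimizing the power amounts to minimizing the gain. -/
lemma div_sub_mul_mono (he0 : 0 ≤ e) {x y : ℝ} (hx : 0 ≤ x) (hxy : x ≤ y) (hy : e * y < 1 - e) :
    x / (1 - e - e * x) ≤ y / (1 - e - e * y) := by
  have := mul_le_mul_of_nonneg_left hxy he0
  exact div_le_div₀ (hx.trans hxy) hxy (by linarith) (by linarith)

lemma hasAveragePower_iff (he0 : 0 ≤ e) (he1 : e < 1) {K : Controller n}
    (hK : MeanSquareStable A B e K) {J : ℝ} :
    HasAveragePower A B e K J ↔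
      J = (1 - e) ^ 2 * gain A B e K / (1 - e - e * ((1 - e) ^ 2 * gain A B e K)) := by
  have h := hasAveragePower_of_gain_lt he0 he1.le hK.1 (hK.gain_lt he0 he1.le)
  rw [average_power_eq he1] at h
  exact ⟨fun hJ => hJ.unique he0 he1.le h, fun hJ => hJ ▸ h⟩

lemma lt_inv_poleProduct_sq_iff :
    e < (poleProduct A ^ 2)⁻¹ ↔ e * (poleProduct A ^ 2 - 1) < 1 - e := by
  have hM : 0 < poleProduct A ^ 2 := pow_pos (one_pos.trans_le (one_le_poleProduct A)) 2
  rw [← one_div, lt_div_iff₀ hM]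
  constructor <;> intro h <;> linarith

theorem meanSquareStabilizable_iff (hAB : Stabilizable A B) (he0 : 0 ≤ e) (he1 : e ≤ 1)
    (hne : e < 1 ∨ unstablePoles A ≠ 0) :
    MeanSquareStabilizable A B e ↔ e < (poleProduct A ^ 2)⁻¹ := by
  have hM : 1 ≤ poleProduct A ^ 2 := one_le_pow₀ (one_le_poleProduct A)
  rcases he1.eq_or_lt with rfl | he
  · have hA := hne.resolve_left (lt_irrefl _)
    exact ⟨fun h => absurd h (not_meanSquareStabilizable_one hA),
      fun h => absurd h (not_lt.2 (inv_le_one_of_one_le₀ hM))⟩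
  rw [lt_inv_poleProduct_sq_iff]
  constructor
  · rintro ⟨K, hK⟩
    have hg := (gain_lt_iff he).1 (hK.gain_lt he0 he1)
    exact (mul_le_mul_of_nonneg_left (poleProduct_sq_sub_one_le A B e hK.1) he0).trans_lt hg
  · intro h
    -- δ is the whole slack in the threshold; it enters the stability condition multiplied by e < 1,
    -- so strictness survives.
    obtain ⟨K, hK, hg⟩ := exists_controller_gain_le_add hAB he.ne
      (δ := (1 - e - e * (poleProduct A ^ 2 - 1))) (by linarith)
    refine ⟨K, (meanSquareStable_iff he0 he1).2 ⟨hK, (gain_lt_iff he).2 ?_⟩⟩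
    refine (mul_le_mul_of_nonneg_left hg he0).trans_lt ?_
    have : e * (1 - e - e * (poleProduct A ^ 2 - 1)) < 1 * (1 - e - e * (poleProduct A ^ 2 - 1)) :=
      mul_lt_mul_of_pos_right he (by linarith)
    linarith

lemma sum_log_unstablePoles :
    ((unstablePoles A).map fun z => Real.log ‖z‖).sum = Real.log (poleProduct A) := by
  have : ∀ s : Multiset ℂ, (∀ z ∈ s, 1 ≤ ‖z‖) →
      0 < (s.map fun z => ‖z‖).prod ∧
        (s.map fun z => Real.log ‖z‖).sum = Real.log (s.map fun z => ‖z‖).prod := by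
    intro s
    induction s using Multiset.induction_on with
    | empty => simp
    | cons l s ih =>
      intro hs
      obtain ⟨h1, h2⟩ := ih fun z hz => hs z (Multiset.mem_cons_of_mem hz)
      have hl : 0 < ‖l‖ := one_pos.trans_le (hs l (Multiset.mem_cons_self l s))
      simp only [Multiset.map_cons, Multiset.prod_cons, Multiset.sum_cons]
      exact ⟨mul_pos hl h1, by rw [h2, Real.log_mul hl.ne' h1.ne']⟩
  exact (this _ fun z hz => one_le_norm_of_mem_unstablePoles A hz).2

/-- Since 1 + (1-e)/e = 1/e, the condition says log M < -(log e)/2. -/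
lemma capacity_iff (he0 : 0 < e) :
    ((unstablePoles A).map fun z => Real.log ‖z‖).sum < 1 / 2 * Real.log (1 + (1 - e) / e) ↔
      e < (poleProduct A ^ 2)⁻¹ := by
  have hM : 0 < poleProduct A := one_pos.trans_le (one_le_poleProduct A)
  rw [sum_log_unstablePoles, show 1 + (1 - e) / e = e⁻¹ by field_simp; ring,
    lt_inv_comm₀ he0 (pow_pos hM 2), ← Real.log_lt_log_iff (pow_pos hM 2) (inv_pos.2 he0),
    Real.log_pow]
  push_cast
  constructor <;> intro h <;> linarith

theorem mem_lowerBounds_stabilizingPowers (he0 : 0 ≤ e) (he1 : e < 1) :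
    (poleProduct A ^ 2 - 1) / (1 - e * poleProduct A ^ 2) ∈
      lowerBounds (stabilizingPowers A B e) := by
  rintro J ⟨K, hK, hJ⟩
  rw [(hasAveragePower_iff he0 he1 hK).1 hJ,
    show 1 - e * poleProduct A ^ 2 = 1 - e - e * (poleProduct A ^ 2 - 1) by ring]
  exact div_sub_mul_mono he0 (sub_nonneg.2 (one_le_pow₀ (one_le_poleProduct A)))
    (poleProduct_sq_sub_one_le A B e hK.1) ((gain_lt_iff he1).1 (hK.gain_lt he0 he1.le))

/-- Controllers within δ of the pole bound have power at most the optimal expression at x + δ, which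
is continuous at δ = 0. -/
theorem isGLB_stabilizingPowers (hAB : Stabilizable A B) (he0 : 0 ≤ e) (he1 : e < 1)
    (he : e < (poleProduct A ^ 2)⁻¹) :
    IsGLB (stabilizingPowers A B e)
      ((poleProduct A ^ 2 - 1) / (1 - e * poleProduct A ^ 2)) := by
  refine ⟨mem_lowerBounds_stabilizingPowers he0 he1, fun b hb => ?_⟩
  rw [lt_inv_poleProduct_sq_iff] at he
  set x := poleProduct A ^ 2 - 1 with hx
  rw [show 1 - e * poleProduct A ^ 2 = 1 - e - e * x by rw [hx]; ring]
  have hcont : ContinuousAt (fun δ : ℝ => (x + δ) / (1 - e - e * (x + δ))) 0 := by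
    refine ContinuousAt.div (by fun_prop) (by fun_prop) ?_
    rw [add_zero]
    linarith
  have hlim := hcont.tendsto.mono_left (nhdsWithin_le_nhds (s := Set.Ioi 0))
  simp only [add_zero] at hlim
  have hsmall : ∀ᶠ δ in 𝓝[>] (0 : ℝ), e * (x + δ) < 1 - e := by
    have hc : ContinuousAt (fun δ : ℝ => e * (x + δ)) 0 := by fun_prop
    refine (hc.tendsto.mono_left nhdsWithin_le_nhds).eventually (gt_mem_nhds ?_)
    rw [add_zero]
    exact he
  refine ge_of_tendsto hlim ?_
  filter_upwards [hsmall, self_mem_nhdsWithin] with δ hδ hδ0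
  obtain ⟨K, hK, hg⟩ := exists_controller_gain_le_add hAB he1.ne hδ0
  have hKs : MeanSquareStable A B e K := (meanSquareStable_iff he0 he1.le).2
    ⟨hK, (gain_lt_iff he1).2 ((mul_le_mul_of_nonneg_left hg he0).trans_lt hδ)⟩
  refine (hb ⟨K, hKs, (hasAveragePower_iff he0 he1 hKs).2 rfl⟩).trans ?_
  exact div_sub_mul_mono he0 (mul_nonneg (sq_nonneg _) gain_nonneg) hg hδ

theorem isLeast_stabilizingPowers (hAB : Stabilizable A B) (he0 : 0 ≤ e) (he1 : e < 1)
    (he : e < (poleProduct A ^ 2)⁻¹) (hA : ∀ z ∈ eigs A, ‖z‖ ≠ 1) :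
    IsLeast (stabilizingPowers A B e)
      ((poleProduct A ^ 2 - 1) / (1 - e * poleProduct A ^ 2)) := by
  refine ⟨?_, mem_lowerBounds_stabilizingPowers he0 he1⟩
  rw [lt_inv_poleProduct_sq_iff] at he
  obtain ⟨K, hK, hg⟩ := exists_controller_gain_le_of_norm_ne_one hAB he1.ne hA
  have hKs : MeanSquareStable A B e K := (meanSquareStable_iff he0 he1.le).2
    ⟨hK, (gain_lt_iff he1).2 ((mul_le_mul_of_nonneg_left hg he0).trans_lt he)⟩
  refine ⟨K, hKs, (hasAveragePower_iff he0 he1 hKs).2 ?_⟩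
  rw [le_antisymm hg (poleProduct_sq_sub_one_le A B e hK)]
  congr 1
  ring

end Optimal

end ErasureControl

end

theorem corollary1 {n : ℕ} (A : Matrix (Fin n) (Fin n) ℝ) (B : Fin n → ℝ)
    (hAB : ErasureControl.Stabilizable A B)
    (e : ℝ) (he0 : 0 ≤ e) (he1 : e ≤ 1)
    (hne : e < 1 ∨ ErasureControl.unstablePoles A ≠ 0) :
    (0 < e →
      (ErasureControl.MeanSquareStabilizable A B e ↔
        ((ErasureControl.unstablePoles A).map fun z => Real.log ‖z‖).sum <
          1 / 2 * Real.log (1 + (1 - e) / e))) ∧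
    (ErasureControl.MeanSquareStabilizable A B e ↔
      e < (ErasureControl.poleProduct A ^ 2)⁻¹) ∧
    (ErasureControl.MeanSquareStabilizable A B e →
      (∀ K : ErasureControl.Controller n, ErasureControl.MeanSquareStable A B e K →
        ∃ J : ℝ, ErasureControl.HasAveragePower A B e K J) ∧
      IsGLB (ErasureControl.stabilizingPowers A B e)
        ((ErasureControl.poleProduct A ^ 2 - 1) / (1 - e * ErasureControl.poleProduct A ^ 2)) ∧
      ((∀ z ∈ ErasureControl.eigs A, ‖z‖ ≠ 1) →
        IsLeast (ErasureControl.stabilizingPowers A B e)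
          ((ErasureControl.poleProduct A ^ 2 - 1) /
            (1 - e * ErasureControl.poleProduct A ^ 2)))) := by
  have hiff := ErasureControl.meanSquareStabilizable_iff hAB he0 he1 hne
  refine ⟨fun he => hiff.trans (ErasureControl.capacity_iff he).symm, hiff, fun hS => ?_⟩
  have he := hiff.1 hS
  have hlt : e < 1 := he.trans_le
    (inv_le_one_of_one_le₀ (one_le_pow₀ (ErasureControl.one_le_poleProduct A)))
  exact ⟨fun K hK => ⟨_, (ErasureControl.hasAveragePower_iff he0 hlt hK).2 rfl⟩,
    ErasureControl.isGLB_stabilizingPowers hAB he0 hlt he,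
    ErasureControl.isLeast_stabilizingPowers hAB he0 hlt he⟩
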